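/- Setting. Let $\mathcal X_1,\mathcal X_2$ be finite alphabets and $\mathcal Y_1,\mathcal Y_2$ reproduction alphabets. A pair of correlated general sources $(\mathbf X_1,\mathbf X_2)$ is a sequence, indexed by $n\ge 1$, of pairs of jointly distributed random variables $(X_1^n,X_2^n)$ with values in $\mathcal X_1^n\times\mathcal X_2^n$, with arbitrary joint laws (no consistency between different $n$ is required). A distortion measure is a sequence of functions $d_n:\mathcal X_1^n\times\mathcal X_2^n\times\mathcal Y_1^n\times\mathcal Y_2^n\to[0,\infty)$, assumed to satisfy $\sup_{n\ge1}\sup d_n<\infty$. A fixed-length code of block length $n$ consists of encoders $\phi_n^{(m)}:\mathcal X_m^n\to\{1,\dots,L_n^{(m)}\}$ and decoders $\psi_n^{(m)}:\{1,\dots,L_n^{(1)}\}\times\{1,\dots,L_n^{(2)}\}\to\mathcal Y_m^n$, $m=1,2$; the rate of an encoder is $R(\phi_n^{(m)})=\frac1n\ln|\phi_n^{(m)}(\mathcal X_m^n)|$, and the estimates are $Y_m^n=\psi_n^{(m)}(\phi_n^{(1)}(X_1^n),\phi_n^{(2)}(X_2^n))$. A triple $(R_1,R_2,D)$ of real numbers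 is $fa$-achievable if there is a sequence of fixed-length codes with $\limsup_{n\to\infty} R(\phi_n^{(m)})\le R_m$ for $m=1,2$ and $\limsup_{n\to\infty}E[d_n(X_1^n,X_2^n,Y_1^n,Y_2^n)]\le D$. For real random variables $A_n$ put $\mathrm{p}\text{-}\limsup_{n\to\infty} A_n=\inf\{\alpha\in\mathbb R:\lim_{n\to\infty}\Pr\{A_n>\alpha\}=0\}$ and $\mathrm{p}\text{-}\liminf_{n\to\infty} A_n=-\,\mathrm{p}\text{-}\limsup_{n\to\infty}(-A_n)$. For $\mathbf V=\{V_n\}$, $\mathbf W=\{W_n\}$ with $V_n,W_n$ jointly distributed discrete random variables, let $\overline I(\mathbf V;\mathbf W)$ and $\underline I(\mathbf V;\mathbf W)$ be the $\mathrm{p}\text{-}\limsup$ and the $\mathrm{p}\text{-}\liminf$ of $\frac1n\ln\frac{P_{V_nW_n}(V_n,W_n)}{P_{V_n}(V_n)P_{W_n}(W_n)}$. Theorem. The triple $(R_1,R_2,D)$ is $fa$-achievable if and only if there exist finite alphabets $\mathcal Z_n^{(1)},\mathcal Z_n^{(2)}$, random variables $(Z_n^{(1)},Z_n^{(2)})$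 with values in $\mathcal Z_n^{(1)}\times\mathcal Z_n^{(2)}$, jointly distributed with $(X_1^n,X_2^n)$, and functions $h_n^{(m)}:\mathcal Z_n^{(1)}\times\mathcal Z_n^{(2)}\to\mathcal Y_m^n$ ($m=1,2$), for $n\ge1$, such that $$P_{X_1^nX_2^nZ_n^{(1)}Z_n^{(2)}}=P_{X_1^nX_2^n}\,P_{Z_n^{(1)}|X_1^n}\,P_{Z_n^{(2)}|X_2^n}\qquad\text{for all } n\ge1,$$ $$\limsup_{n\to\infty}E\Bigl[d_n\bigl(X_1^n,X_2^n,h_n^{(1)}(Z_n^{(1)},Z_n^{(2)}),h_n^{(2)}(Z_n^{(1)},Z_n^{(2)})\bigr)\Bigr]\le D,$$ and, with $\mathbf Z^{(m)}=\{Z_n^{(m)}\}_{n\ge1}$, $$R_1\ge\overline I(\mathbf X_1;\mathbf Z^{(1)})-\underline I(\mathbf Z^{(1)};\mathbf Z^{(2)}),$$ $$R_2\ge\overline I(\mathbf X_2;\mathbf Z^{(2)})-\underline I(\mathbf Z^{(1)};\mathbf Z^{(2)}),$$ $$R_1+R_2\ge\overline I(\mathbf X_1;\mathbf Z^{(1)})+\overline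 I(\mathbf X_2;\mathbf Z^{(2)})-\underline I(\mathbf Z^{(1)};\mathbf Z^{(2)}).$$ -/

import Mathlib

open Filter Topology
open scoped NNReal

noncomputable section

namespace MultiterminalCoding

/-! Sequences are indexed by all `n : ℕ`, but only the terms with `n ≥ 1` are ever constrained;
every asymptotic notion below is insensitive to the term `n = 0`. -/

/-- A pair of correlated general sources with alphabets `𝒳₁`, `𝒳₂`: for every `n`, an arbitrary
joint law of `(X₁ⁿ, X₂ⁿ)` on `𝒳₁ⁿ × 𝒳₂ⁿ`. No consistency between different `n` is required. -/
abbrev SourcePair (𝒳₁ 𝒳₂ : Type*) : Type _ :=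
  (n : ℕ) → PMF ((Fin n → 𝒳₁) × (Fin n → 𝒳₂))

/-- A general distortion measure: functions `dₙ : 𝒳₁ⁿ × 𝒳₂ⁿ × 𝒴₁ⁿ × 𝒴₂ⁿ → [0, ∞)`. -/
abbrev Distortion (𝒳₁ 𝒳₂ 𝒴₁ 𝒴₂ : Type*) : Type _ :=
  (n : ℕ) → (Fin n → 𝒳₁) → (Fin n → 𝒳₂) → (Fin n → 𝒴₁) → (Fin n → 𝒴₂) → ℝ≥0

/-- The distortion measure is bounded, uniformly in the block length. -/
def Distortion.Bounded {𝒳₁ 𝒳₂ 𝒴₁ 𝒴₂ : Type*} (d : Distortion 𝒳₁ 𝒳₂ 𝒴₁ 𝒴₂) : Prop :=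
  ∃ D₀ : ℝ≥0, ∀ n : ℕ, 1 ≤ n → ∀ x₁ x₂ y₁ y₂, d n x₁ x₂ y₁ y₂ ≤ D₀

/-- Expectation of a real function on a finite sample space. -/
def expect {Ω : Type*} [Fintype Ω] (p : PMF Ω) (f : Ω → ℝ) : ℝ :=
  ∑ ω, (p ω).toReal * f ω

/-- Limit superior in probability, `inf {α ∈ ℝ | lim Pr {Zₙ > α} = 0}`, as an extended real.
The variable `Zₙ` lives on its own discrete probability space `(Ω n, p n)`. -/
def pLimsup {Ω : ℕ → Type*} (p : (n : ℕ) → PMF (Ω n)) (Z : (n : ℕ) → Ω n → ℝ) : EReal :=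
  sInf ((fun α : ℝ => (α : EReal)) ''
    {α : ℝ | Tendsto (fun n => (p n).toOuterMeasure {ω | α < Z n ω}) atTop (𝓝 0)})

/-- Limit inferior in probability. -/
def pLiminf {Ω : ℕ → Type*} (p : (n : ℕ) → PMF (Ω n)) (Z : (n : ℕ) → Ω n → ℝ) : EReal :=
  - pLimsup p (fun n ω => - Z n ω)

/-- Normalized information density `(1/n) ln (P_{VW}(v,w) / (P_V(v) P_W(w)))` of a joint law. -/
def infoDensity {α β : Type*} (n : ℕ) (p : PMF (α × β)) (vw : α × β) : ℝ :=
  (1 / (n : ℝ)) *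
    Real.log ((p vw).toReal /
      (((p.map Prod.fst) vw.1).toReal * ((p.map Prod.snd) vw.2).toReal))

/-- Spectral sup-mutual information rate of a sequence of joint laws of `(Vₙ, Wₙ)`. -/
def supInfoRate {α β : ℕ → Type*} (p : (n : ℕ) → PMF (α n × β n)) : EReal :=
  pLimsup p (fun n => infoDensity n (p n))

/-- Spectral inf-mutual information rate of a sequence of joint laws of `(Vₙ, Wₙ)`. -/
def infInfoRate {α β : ℕ → Type*} (p : (n : ℕ) → PMF (α n × β n)) : EReal :=
  pLiminf p (fun n => infoDensity n (p n))

/-- Conditional probability `P_{W|V}(w|v)` of a joint law of `(V, W)` (zero if `P_V(v) = 0`). -/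
def condProb {α β : Type*} (p : PMF (α × β)) (w : β) (v : α) : ℝ :=
  (p (v, w)).toReal / ((p.map Prod.fst) v).toReal

/-- A fixed-length code of block length `n`: two separate encoders into index sets of sizes
`L₁`, `L₂`, and a common decoder, given by two maps. -/
structure Code (𝒳₁ 𝒳₂ 𝒴₁ 𝒴₂ : Type*) (n : ℕ) where
  /-- size of the first index set -/
  L₁ : ℕ
  /-- size of the second index set -/
  L₂ : ℕ
  /-- first encoder -/
  φ₁ : (Fin n → 𝒳₁) → Fin L₁
  /-- second encoder -/
  φ₂ : (Fin n → 𝒳₂) → Fin L₂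
  /-- decoder for the first source -/
  ψ₁ : Fin L₁ × Fin L₂ → (Fin n → 𝒴₁)
  /-- decoder for the second source -/
  ψ₂ : Fin L₁ × Fin L₂ → (Fin n → 𝒴₂)

/-- Rate of an encoder of block length `n`: `(1/n) ln |φ(𝒳ⁿ)|`. -/
def rate {α β : Type*} (n : ℕ) (φ : α → β) : ℝ :=
  Real.log ((Set.range φ).ncard : ℝ) / (n : ℝ)

/-- `(R₁, R₂, D)` is achievable by fixed-length codes under the average distortion criterion. -/
def FaAchievable {𝒳₁ 𝒳₂ 𝒴₁ 𝒴₂ : Type*} [Fintype 𝒳₁] [Fintype 𝒳₂]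
    (P : SourcePair 𝒳₁ 𝒳₂) (d : Distortion 𝒳₁ 𝒳₂ 𝒴₁ 𝒴₂) (R₁ R₂ D : ℝ) : Prop :=
  ∃ c : (n : ℕ) → Code 𝒳₁ 𝒳₂ 𝒴₁ 𝒴₂ n,
    limsup (fun n => ((rate n (c n).φ₁ : ℝ) : EReal)) atTop ≤ (R₁ : EReal) ∧
    limsup (fun n => ((rate n (c n).φ₂ : ℝ) : EReal)) atTop ≤ (R₂ : EReal) ∧
    limsup (fun n => ((expect (P n) (fun x =>
        (d n x.1 x.2
          ((c n).ψ₁ ((c n).φ₁ x.1, (c n).φ₂ x.2))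
          ((c n).ψ₂ ((c n).φ₁ x.1, (c n).φ₂ x.2)) : ℝ)) : ℝ) : EReal)) atTop ≤ (D : EReal)

/-- Marginal law of `(X₁, Z₁)` under a joint law of `((X₁, X₂), (Z₁, Z₂))`. -/
def margX1Z1 {α₁ α₂ β₁ β₂ : Type*} (q : PMF ((α₁ × α₂) × (β₁ × β₂))) : PMF (α₁ × β₁) :=
  q.map (fun t => (t.1.1, t.2.1))

/-- Marginal law of `(X₂, Z₂)` under a joint law of `((X₁, X₂), (Z₁, Z₂))`. -/
def margX2Z2 {α₁ α₂ β₁ β₂ : Type*} (q : PMF ((α₁ × α₂) × (β₁ × β₂))) : PMF (α₂ × β₂) :=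
  q.map (fun t => (t.1.2, t.2.2))

/-- Marginal law of `(Z₁, Z₂)` under a joint law of `((X₁, X₂), (Z₁, Z₂))`. -/
def margZ1Z2 {α₁ α₂ β₁ β₂ : Type*} (q : PMF ((α₁ × α₂) × (β₁ × β₂))) : PMF (β₁ × β₂) :=
  q.map Prod.snd

/-- `q` is a joint law of `((X₁, X₂), (Z₁, Z₂))` whose `(X₁, X₂)`-marginal is `p` and which
satisfies `P_{X₁X₂Z₁Z₂} = P_{X₁X₂} P_{Z₁|X₁} P_{Z₂|X₂}`. -/
def SeparatelyGenerated {α₁ α₂ β₁ β₂ : Type*} (p : PMF (α₁ × α₂))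
    (q : PMF ((α₁ × α₂) × (β₁ × β₂))) : Prop :=
  q.map Prod.fst = p ∧
  ∀ x₁ x₂ z₁ z₂, (q ((x₁, x₂), (z₁, z₂))).toReal =
    (p (x₁, x₂)).toReal * condProb (margX1Z1 q) z₁ x₁ * condProb (margX2Z2 q) z₂ x₂

end MultiterminalCoding

end

/-! Converse: take `Z⁽ᵐ⁾` to be the transmitted index and `h⁽ᵐ⁾` the decoder. Deterministic separate
descriptions satisfy the factorization. The index takes at most `exp (n (R_m + ε))` values, so the
sup-information rate between source and index is at most `R_m`. The inf-information rate between the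
two indices is nonnegative, so subtracting it only helps.

Achievability rests on the one-shot bound `exists_oneShot_code`. Each terminal draws a codebook of
about `exp (n a_m)` words from the law of `Z⁽ᵐ⁾`, with `a_m` just above the sup-information rate
between `X_m` and `Z⁽ᵐ⁾`. It selects a word by rejection sampling: each word accepts `x` with a
probability chosen so that the first accepted word follows the channel `P_{Z⁽ᵐ⁾|X_m}` truncated at
`exp (n a_m)` times its output law. The truncated mass is a tail of the information density. Since
the two selections are independent given the sources, the selected pair has nearly the prescribed
joint law, so both the distortion and the joint typicality of the pair are inherited, without a
Markov lemma.

Only the bin of the selected index is sent. The decoder looks for the unique pair in the two bins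
whose density is at least `b`, with `b` just below the inf-information rate between `Z⁽¹⁾` and
`Z⁽²⁾`. Independent words pass this test with probability at most `exp (-n b)`; the three kinds of
wrong pair (one or both indices wrong) give the three rate inequalities.

A data-processing inequality, `one_le_expect_infoDensity_add`, makes the rates `R_m` nonnegative,
and alphabet bounds make all spectral quantities finite. A diagonal argument then lets the tolerance
tend to zero. -/

namespace MultiterminalCoding

/-! ### Averages over i.i.d. vectors. -/

section OneShot

open scoped Classical

/-- The real-valued indicator of a proposition. -/
noncomputable def ind (p : Prop) : ℝ := if p then 1 else 0

theorem ind_eq (p : Prop) [Decidable p] : ind p = if p then 1 else 0 := by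
  unfold ind; congr

@[simp] theorem ind_of {p : Prop} (h : p) : ind p = 1 := if_pos h

@[simp] theorem ind_of_not {p : Prop} (h : ¬ p) : ind p = 0 := if_neg h

theorem ind_nonneg (p : Prop) : 0 ≤ ind p := by
  unfold ind; split_ifs <;> norm_num

theorem ind_le_one (p : Prop) : ind p ≤ 1 := by
  unfold ind; split_ifs <;> norm_num

theorem ind_mono {p q : Prop} (h : p → q) : ind p ≤ ind q := by
  by_cases hp : p
  · rw [ind_of hp, ind_of (h hp)]
  · rw [ind_of_not hp]; exact ind_nonneg q

theorem sum_pi_prod {M : ℕ} {T : Type*} [Fintype T] (f : Fin M → T → ℝ) :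
    ∑ t : Fin M → T, ∏ i, f i (t i) = ∏ i, ∑ a, f i a := by
  rw [Finset.prod_univ_sum, Fintype.piFinset_univ]

theorem sum_pi_prod_eq_one {M : ℕ} {T : Type*} [Fintype T] {w : T → ℝ} (hw : ∑ a, w a = 1) :
    ∑ t : Fin M → T, ∏ i, w (t i) = 1 := by
  rw [sum_pi_prod]; simp [hw]

/-- The marginal of one coordinate of an i.i.d. vector. -/
theorem sum_pi_prod_mul {M : ℕ} {T : Type*} [Fintype T] {w : T → ℝ} (hw : ∑ a, w a = 1)
    (i : Fin M) (f : T → ℝ) :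
    ∑ t : Fin M → T, (∏ j, w (t j)) * f (t i) = ∑ a, w a * f a := by
  have h : ∀ t : Fin M → T, (∏ j, w (t j)) * f (t i)
      = ∏ j, (w (t j) * if j = i then f (t j) else 1) := by
    intro t
    rw [Finset.prod_mul_distrib, Finset.prod_ite_eq' Finset.univ i (fun j => f (t j))]
    simp
  simp_rw [h]
  rw [sum_pi_prod (fun j a => w a * if j = i then f a else 1)]
  have h2 : ∀ j : Fin M, (∑ a, w a * if j = i then f a else 1)
      = if j = i then ∑ a, w a * f a else 1 := by
    intro j; split_ifs <;> simp [hw]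
  simp_rw [h2]
  simp

/-- Two distinct coordinates of a uniform vector collide with probability `1 / B`. -/
theorem sum_uniform_collision {M B : ℕ} (hB : 0 < B) {i i' : Fin M} (hi : i ≠ i') :
    ∑ b : Fin M → Fin B, (∏ _j : Fin M, (1 / (B : ℝ))) * ind (b i = b i')
      = 1 / (B : ℝ) := by
  simp only [ind_eq]
  have hB' : (B : ℝ) ≠ 0 := by positivity
  -- Splitting the collision by the common value `c` makes each summand a product over coordinates.
  have h : ∀ b : Fin M → Fin B,
      (∏ _j : Fin M, (1 / (B : ℝ))) * (if b i = b i' then 1 else 0)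
      = ∑ c, ∏ j, (1 / (B : ℝ) * if j = i ∨ j = i' then (if b j = c then 1 else 0) else 1) := by
    intro b
    have : ∀ c, ∏ j : Fin M, (1 / (B : ℝ) * if j = i ∨ j = i' then
        (if b j = c then (1 : ℝ) else 0) else 1)
        = (∏ _j : Fin M, (1 / (B : ℝ))) * if b i = c then (if b i' = c then 1 else 0) else 0 := by
      intro c
      rw [Finset.prod_mul_distrib]
      congr 1
      split_ifs with h1 h2
      · apply Finset.prod_eq_one
        rintro j -
        split_ifs with h3 h4
        · rfl
        · rcases h3 with rfl | rfl <;> contradiction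
        · rfl
      · exact Finset.prod_eq_zero (Finset.mem_univ i') (by simp [h2])
      · exact Finset.prod_eq_zero (Finset.mem_univ i) (by simp [h1])
    simp_rw [this, ← Finset.mul_sum]
    congr 1
    simp [eq_comm]
  simp_rw [h]
  rw [Finset.sum_comm]
  have h2 : ∀ c : Fin B, ∑ b : Fin M → Fin B, ∏ j,
      (1 / (B : ℝ) * if j = i ∨ j = i' then (if b j = c then (1 : ℝ) else 0) else 1)
      = (1 / (B : ℝ)) ^ 2 := by
    intro c
    rw [sum_pi_prod (fun j a => 1 / (B : ℝ) * if j = i ∨ j = i' then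
      (if a = c then (1 : ℝ) else 0) else 1)]
    have : ∀ j : Fin M, (∑ a : Fin B, 1 / (B : ℝ) * if j = i ∨ j = i' then
        (if a = c then (1 : ℝ) else 0) else 1)
        = (if j = i then 1 / (B : ℝ) else 1) * (if j = i' then 1 / (B : ℝ) else 1) := by
      intro j
      by_cases h1 : j = i
      · subst h1; simp [hi]
      · by_cases h2 : j = i'
        · subst h2; simp [h1]
        · simp [h1, h2, hB']
    simp_rw [this]
    rw [Finset.prod_mul_distrib]
    simp [sq]
  simp_rw [h2]
  simp
  field_simp

/-- The first accepted entry of an i.i.d. sequence follows, up to the probability that nothing is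
accepted, the law of an entry conditioned on acceptance. -/
theorem sum_firstMatch_mul_le {M : ℕ} {T : Type*} [Fintype T] {w : T → ℝ} (hw0 : ∀ a, 0 ≤ w a)
    (hw : ∑ a, w a = 1) (s r : T → Prop) :
    (∑ t : Fin M → T, (∏ i, w (t i)) *
        ind (∃ i, r (t i) ∧ ∀ j < i, ¬ s (t j))) *
      (∑ a, w a * ind (s a)) ≤ ∑ a, w a * ind (r a) := by
  simp only [ind_eq]
  set p := ∑ a, w a * if s a then (1 : ℝ) else 0 with hp
  set v := ∑ a, w a * if r a then (1 : ℝ) else 0 with hv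
  have hp0 : 0 ≤ p := Finset.sum_nonneg fun a _ => mul_nonneg (hw0 a) (by split_ifs <;> norm_num)
  have hv0 : 0 ≤ v := Finset.sum_nonneg fun a _ => mul_nonneg (hw0 a) (by split_ifs <;> norm_num)
  have hp' : ∑ a, w a * (if s a then (0 : ℝ) else 1) = 1 - p := by
    rw [eq_sub_iff_add_eq, hp, ← Finset.sum_add_distrib]
    refine (Finset.sum_congr rfl fun a _ => ?_).trans hw
    split_ifs <;> simp
  have hp1 : 0 ≤ 1 - p := by
    rw [← hp']
    exact Finset.sum_nonneg fun a _ => mul_nonneg (hw0 a) (by split_ifs <;> norm_num)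
  -- Union bound over the position `i`: the `i` earlier entries are rejected and entry `i` satisfies
  -- `r`, which has probability `(1 - p) ^ i * v`.
  have hle : (∑ t : Fin M → T, (∏ i, w (t i)) *
        (if ∃ i, r (t i) ∧ ∀ j < i, ¬ s (t j) then (1 : ℝ) else 0)) ≤
      ∑ i : Fin M, (1 - p) ^ (i : ℕ) * v := by
    have h1 : ∀ i : Fin M, (1 - p) ^ (i : ℕ) * v = ∑ t : Fin M → T, ∏ j, (w (t j) *
        ((if j < i then (if s (t j) then (0 : ℝ) else 1) else 1) *
          (if j = i then (if r (t j) then (1 : ℝ) else 0) else 1))) := by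
      intro i
      rw [sum_pi_prod (fun j a => w a *
        ((if j < i then (if s a then (0 : ℝ) else 1) else 1) *
          (if j = i then (if r a then (1 : ℝ) else 0) else 1)))]
      have : ∀ j : Fin M, (∑ a, w a *
        ((if j < i then (if s a then (0 : ℝ) else 1) else 1) *
          (if j = i then (if r a then (1 : ℝ) else 0) else 1)))
          = (if j < i then 1 - p else 1) * (if j = i then v else 1) := by
        intro j
        rcases lt_trichotomy j i with h | h | h
        · simp only [h, h.ne, if_true, if_false, mul_one]; exact hp'
        · simp [h, hv]
        · simp [h.not_gt, h.ne', hw]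
      simp_rw [this]
      rw [Finset.prod_mul_distrib, Finset.prod_ite_eq' Finset.univ i (fun _ => v),
        Finset.prod_ite]
      have hc : (Finset.univ.filter (fun j : Fin M => j < i)).card = (i : ℕ) := by
        rw [← Fin.card_Iio i]; congr 1; ext; simp
      simp [hc]
    simp_rw [h1]
    rw [Finset.sum_comm]
    refine Finset.sum_le_sum fun t _ => ?_
    have hnn : ∀ i : Fin M, 0 ≤ ∏ j, (w (t j) *
        ((if j < i then (if s (t j) then (0 : ℝ) else 1) else 1) *
          (if j = i then (if r (t j) then (1 : ℝ) else 0) else 1))) := by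
      intro i
      refine Finset.prod_nonneg fun j _ => mul_nonneg (hw0 _) (mul_nonneg ?_ ?_)
      · split_ifs <;> norm_num
      · split_ifs <;> norm_num
    split_ifs with h
    · obtain ⟨i, hi, hj⟩ := h
      refine le_trans (le_of_eq ?_) (Finset.single_le_sum (fun i _ => hnn i) (Finset.mem_univ i))
      rw [Finset.prod_mul_distrib]
      congr 1
      symm
      refine Finset.prod_eq_one fun j _ => ?_
      rcases lt_trichotomy j i with h | h | h
      · simp [h, h.ne, hj j h]
      · subst h; simp [hi]
      · simp [h.not_gt, h.ne']
    · rw [mul_zero]; exact Finset.sum_nonneg fun i _ => hnn i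
  -- The geometric sum times `p` is `1 - (1 - p) ^ M ≤ 1`. Multiplying by `p` instead of dividing
  -- covers `p = 0`.
  refine (mul_le_mul_of_nonneg_right hle hp0).trans ?_
  rw [← Finset.sum_mul, Fin.sum_univ_eq_sum_range (fun i => (1 - p) ^ i) M]
  have hg := geom_sum_mul_neg (1 - p) M
  have : (∑ i ∈ Finset.range M, (1 - p) ^ i) * p ≤ 1 := by
    have e : (1 - (1 - p)) = p := by ring
    rw [e] at hg
    rw [hg]; have := pow_nonneg hp1 M; linarith
  calc _ = ((∑ i ∈ Finset.range M, (1 - p) ^ i) * p) * v := by ring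
    _ ≤ 1 * v := mul_le_mul_of_nonneg_right this hv0
    _ = v := one_mul v

/-- The probability that no entry of an i.i.d. sequence is accepted. -/
theorem sum_noMatch {M : ℕ} {T : Type*} [Fintype T] {w : T → ℝ}
    (hw : ∑ a, w a = 1) (s : T → Prop) :
    ∑ t : Fin M → T, (∏ i, w (t i)) * ind (¬ ∃ i, s (t i))
      = (1 - ∑ a, w a * ind (s a)) ^ M := by
  have h0 : ∀ (p : Prop) [Decidable p], ind (¬ p) = if p then 0 else 1 := by
    intro p _; by_cases h : p <;> simp [h]
  simp only [h0, ind_eq]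
  have h : ∀ t : Fin M → T, (∏ i, w (t i)) * (if ∃ i, s (t i) then (0 : ℝ) else 1)
      = ∏ i, (w (t i) * if s (t i) then 0 else 1) := by
    intro t
    rw [Finset.prod_mul_distrib]
    congr 1
    split_ifs with h
    · obtain ⟨i, hi⟩ := h
      exact (Finset.prod_eq_zero (Finset.mem_univ i) (by simp [hi])).symm
    · push Not at h
      simp [h]
  simp_rw [h]
  rw [sum_pi_prod (fun _ a => w a * if s a then 0 else 1)]
  have : ∑ a, w a * (if s a then (0 : ℝ) else 1) = 1 - ∑ a, w a * if s a then 1 else 0 := by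
    rw [eq_sub_iff_add_eq, ← Finset.sum_add_distrib]
    refine (Finset.sum_congr rfl fun a _ => ?_).trans hw
    split_ifs <;> simp
  rw [this, Finset.prod_const, Finset.card_univ, Fintype.card_fin]

/-- A value not exceeding the average is attained. -/
theorem exists_le_of_weighted_sum_le {T : Type*} [Fintype T] {w : T → ℝ} (hw0 : ∀ a, 0 ≤ w a)
    (hw : ∑ a, w a = 1) {f : T → ℝ} {C : ℝ} (h : ∑ a, w a * f a ≤ C) : ∃ a, f a ≤ C := by
  by_contra! hc
  have h1 : ∃ a, 0 < w a := by
    by_contra! h0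
    have : ∑ a, w a ≤ 0 := Finset.sum_nonpos fun a _ => h0 a
    linarith
  obtain ⟨a, ha⟩ := h1
  have : ∑ a, w a * C < ∑ a, w a * f a :=
    Finset.sum_lt_sum (fun b _ => mul_le_mul_of_nonneg_left (hc b).le (hw0 b))
      ⟨a, Finset.mem_univ a, mul_lt_mul_of_pos_left (hc a) ha⟩
  rw [← Finset.sum_mul, hw] at this
  linarith

/-! ### Rejection sampling from a random codebook. -/

/-- Random acceptance sets realizing prescribed acceptance probabilities. -/
theorem exists_acceptance {X Z : Type*} [Fintype X] [Fintype Z] {pZ : Z → ℝ}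
    (hp0 : ∀ z, 0 ≤ pZ z) (hp : ∑ z, pZ z = 1) {W : X → Z → ℝ} (hW0 : ∀ x z, 0 ≤ W x z)
    {K : ℝ} (hK : 0 < K) :
    ∃ w : Z × (X → Bool) → ℝ, (∀ a, 0 ≤ w a) ∧ ∑ a, w a = 1 ∧
      (∀ f : Z → ℝ, ∑ a, w a * f a.1 = ∑ z, pZ z * f z) ∧
      ∀ x z, ∑ a, w a * ind (a.2 x = true ∧ a.1 = z) = min (pZ z) (W x z / K) := by
  -- A word `z` drawn from `pZ` tosses, independently for each `x`, a coin of bias `A x z`; then `pZ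
  -- z * A x z` is the required minimum.
  set A : X → Z → ℝ := fun x z => min 1 (W x z / (K * pZ z)) with hA
  have hA0 : ∀ x z, 0 ≤ A x z := fun x z =>
    le_min zero_le_one (div_nonneg (hW0 x z) (mul_nonneg hK.le (hp0 z)))
  have hA1 : ∀ x z, 0 ≤ 1 - A x z := fun x z => sub_nonneg.2 (min_le_left _ _)
  have hsum : ∀ z, ∑ s : X → Bool, ∏ x, (if s x = true then A x z else 1 - A x z) = 1 := by
    intro z
    have := Finset.prod_univ_sum (fun _ : X => (Finset.univ : Finset Bool))
      (fun x b => if b = true then A x z else 1 - A x z)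
    rw [Fintype.piFinset_univ] at this
    rw [← this]
    simp
  have hmarg : ∀ f : Z → ℝ, ∑ a : Z × (X → Bool),
      (pZ a.1 * ∏ x, (if a.2 x = true then A x a.1 else 1 - A x a.1)) * f a.1
      = ∑ z, pZ z * f z := by
    intro f
    rw [Fintype.sum_prod_type]
    refine Finset.sum_congr rfl fun z _ => ?_
    simp only
    rw [← Finset.sum_mul, ← Finset.mul_sum, hsum, mul_one]
  refine ⟨fun a => pZ a.1 * ∏ x, (if a.2 x = true then A x a.1 else 1 - A x a.1), ?_, ?_, hmarg,
    ?_⟩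
  · intro a
    refine mul_nonneg (hp0 _) (Finset.prod_nonneg fun x _ => ?_)
    split_ifs
    exacts [hA0 _ _, hA1 _ _]
  · simpa [hp] using hmarg (fun _ => 1)
  · intro x z
    simp only [ind_eq]
    rw [Fintype.sum_prod_type]
    rw [Finset.sum_eq_single z]
    · simp only [and_true]
      have h : ∀ s : X → Bool, pZ z * (∏ y, (if s y = true then A y z else 1 - A y z)) *
          (if s x = true then 1 else 0) = pZ z * ∏ y, ((if s y = true then A y z else 1 - A y z) *
            if y = x then (if s y = true then 1 else 0) else 1) := by
        intro s
        rw [mul_assoc, Finset.prod_mul_distrib,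
          Finset.prod_ite_eq' Finset.univ x (fun y => if s y = true then (1 : ℝ) else 0)]
        simp
      simp_rw [h]
      rw [← Finset.mul_sum]
      have := Finset.prod_univ_sum (fun _ : X => (Finset.univ : Finset Bool))
        (fun y b => (if b = true then A y z else 1 - A y z) *
            if y = x then (if b = true then 1 else 0) else 1)
      rw [Fintype.piFinset_univ] at this
      rw [← this]
      have h2 : ∀ y, (∑ b : Bool, (if b = true then A y z else 1 - A y z) *
            if y = x then (if b = true then 1 else 0) else 1) = if y = x then A y z else 1 := by
        intro y
        split_ifs <;> simp
      simp_rw [h2]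
      rw [Finset.prod_ite_eq' Finset.univ x (fun y => A y z)]
      simp only [Finset.mem_univ, if_true, hA]
      -- For a word of zero mass both sides vanish, whatever the division by zero in `A` gives.
      rcases (hp0 z).eq_or_lt with h0 | h0
      · rw [← h0]; simp [div_nonneg (hW0 x z) hK.le]
      · rw [mul_min_of_nonneg _ _ h0.le, mul_one]
        congr 1
        field_simp
    · intro z' _ hz
      simp [hz]
    · simp

/-- Rejection sampling from a random codebook: a probability distribution on codebooks of `M`
words, each word having law `pZ`, and encoders selecting for `x` a word whose law is close to
`W x`. -/
theorem exists_rejection_codebook {X : Type*} {Z : Type*} [Fintype X] [Fintype Z] {pZ : Z → ℝ}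
    (hp0 : ∀ z, 0 ≤ pZ z) (hp : ∑ z, pZ z = 1) {W : X → Z → ℝ} (hW0 : ∀ x z, 0 ≤ W x z)
    (hW1 : ∀ x, ∑ z, W x z ≤ 1) {K : ℝ} (hK : 0 < K) {M : ℕ} (hM : 0 < M) :
    ∃ (wt : (Fin M → Z × (X → Bool)) → ℝ) (enc : (Fin M → Z × (X → Bool)) → X → Fin M)
      (found : (Fin M → Z × (X → Bool)) → X → Prop),
      (∀ t, 0 ≤ wt t) ∧ ∑ t, wt t = 1 ∧
      (∀ i (f : Z → ℝ), ∑ t, wt t * f (t i).1 = ∑ z, pZ z * f z) ∧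
      (∀ x z, (∑ t, wt t * ind (found t x ∧ (t (enc t x)).1 = z)) *
        (∑ z, min (K * pZ z) (W x z)) ≤ W x z) ∧
      (∀ x, ∑ t, wt t * ind (¬ found t x) ≤
        (1 - ∑ z, min (K * pZ z) (W x z)) + Real.exp (-(M / K))) := by
  obtain ⟨w, hw0, hw1, hwm, hwa⟩ := exists_acceptance hp0 hp hW0 hK
  -- The encoder takes the first accepting word, and index `0` when no word accepts.
  have hfirst : ∀ (t : Fin M → Z × (X → Bool)) (x : X), ∃ i, (∃ k, (t k).2 x = true) →
      (t i).2 x = true ∧ ∀ j < i, ¬ (t j).2 x = true := by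
    intro t x
    by_cases h : ∃ k, (t k).2 x = true
    · have hne : (Finset.univ.filter fun k => (t k).2 x = true).Nonempty := by
        obtain ⟨k, hk⟩ := h; exact ⟨k, by simp [hk]⟩
      refine ⟨Finset.min' _ hne, fun _ => ⟨?_, fun j hj hjx => ?_⟩⟩
      · simpa using Finset.min'_mem _ hne
      · exact absurd hj (not_lt.2 (Finset.min'_le _ _ (by simp [hjx])))
    · exact ⟨⟨0, hM⟩, fun h' => absurd h' h⟩
  choose enc henc using hfirst
  have hmin : ∀ x z, K * min (pZ z) (W x z / K) = min (K * pZ z) (W x z) := by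
    intro x z
    rw [mul_min_of_nonneg _ _ hK.le]
    congr 1
    field_simp
  -- A single word accepts `x` with probability `c / K`, where `c` is the mass of the channel
  -- truncated at `K * pZ`.
  have hacc : ∀ x, K * (∑ a, w a * ind (a.2 x = true))
      = ∑ z, min (K * pZ z) (W x z) := by
    intro x
    simp_rw [← hmin, ← Finset.mul_sum, ← hwa]
    rw [Finset.sum_comm]
    congr 1
    refine Finset.sum_congr rfl fun a _ => ?_
    rw [← Finset.mul_sum]
    congr 1
    by_cases h : a.2 x = true <;> simp [h, ind_eq]
  refine ⟨fun t => ∏ i, w (t i), enc, fun t x => ∃ k, (t k).2 x = true,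
    fun t => Finset.prod_nonneg fun i _ => hw0 _, sum_pi_prod_eq_one hw1, ?_, ?_, ?_⟩
  · intro i f
    rw [sum_pi_prod_mul hw1 i (fun a => f a.1), hwm]
  · intro x z
    have h1 := sum_firstMatch_mul_le (M := M) hw0 hw1 (fun a => a.2 x = true)
      (fun a => a.2 x = true ∧ a.1 = z)
    rw [hwa] at h1
    have h2 : ∀ t : Fin M → Z × (X → Bool),
        ind ((∃ k, (t k).2 x = true) ∧ (t (enc t x)).1 = z) ≤
        ind (∃ i, ((t i).2 x = true ∧ (t i).1 = z) ∧ ∀ j < i, ¬ (t j).2 x = true) := by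
      intro t
      exact ind_mono fun h3 => ⟨enc t x, ⟨(henc t x h3.1).1, h3.2⟩, (henc t x h3.1).2⟩
    have h3 : 0 ≤ ∑ a, w a * ind (a.2 x = true) :=
      Finset.sum_nonneg fun a _ => mul_nonneg (hw0 a) (ind_nonneg _)
    have h4 := (mul_le_mul_of_nonneg_right (Finset.sum_le_sum fun t (_ : t ∈ Finset.univ) =>
      mul_le_mul_of_nonneg_left (h2 t) (Finset.prod_nonneg fun i _ => hw0 (t i))) h3).trans h1
    rw [← hacc]
    calc _ = K * ((∑ t : Fin M → Z × (X → Bool), (∏ i, w (t i)) *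
          ind ((∃ k, (t k).2 x = true) ∧ (t (enc t x)).1 = z)) *
          ∑ a, w a * ind (a.2 x = true)) := by ring
      _ ≤ K * min (pZ z) (W x z / K) := mul_le_mul_of_nonneg_left h4 hK.le
      _ ≤ W x z := by rw [hmin]; exact min_le_right _ _
  · intro x
    simp only
    rw [sum_noMatch hw1 (fun a : Z × (X → Bool) => a.2 x = true)]
    set p := ∑ a, w a * ind (a.2 x = true) with hpdef
    set c := ∑ z, min (K * pZ z) (W x z) with hc
    have hpc : p = c / K := by rw [hc, ← hacc x, mul_div_cancel_left₀ _ hK.ne']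
    have hc0 : 0 ≤ c := Finset.sum_nonneg fun z _ => le_min (mul_nonneg hK.le (hp0 z)) (hW0 x z)
    have hc1 : c ≤ 1 := (Finset.sum_le_sum fun z _ => min_le_right _ _).trans (hW1 x)
    have hp1 : p ≤ 1 := by
      rw [hpdef, ← hw1]
      refine Finset.sum_le_sum fun a _ => ?_
      exact mul_le_of_le_one_right (hw0 a) (ind_le_one _)
    have h1 : (1 - p) ^ M ≤ Real.exp (-(M * p)) := by
      have h2 : 1 - p ≤ Real.exp (-p) := by have := Real.add_one_le_exp (-p); linarith
      calc (1 - p) ^ M ≤ Real.exp (-p) ^ M := pow_le_pow_left₀ (by linarith) h2 M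
        _ = Real.exp (-(M * p)) := by rw [← Real.exp_nat_mul]; ring_nf
    -- Convexity between `0` and `-M/K`, with `p = c/K`: `exp (-M p) ≤ (1 - c) + c * exp (-M/K)`.
    -- This separates the truncation loss from the covering failure.
    have h2 := convexOn_exp.2 (Set.mem_univ (0 : ℝ)) (Set.mem_univ (-(M / K) : ℝ))
      (sub_nonneg.2 hc1) hc0 (by ring)
    simp only [smul_eq_mul, mul_zero, zero_add, Real.exp_zero, mul_one] at h2
    have h3 : c * -(M / K) = -(M * p) := by rw [hpc]; ring
    rw [h3] at h2
    have h4 : c * Real.exp (-(M / K)) ≤ Real.exp (-(M / K)) :=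
      mul_le_of_le_one_left (Real.exp_pos _).le hc1
    linarith

/-! ### Random binning. -/

/-- Random binning: for some pair of binnings, the probability that a pair of indices other than
the encoded one is admissible and falls into the same bins is at most the average over all
binnings. -/
theorem exists_binning {X : Type*} [Fintype X] {P : X → ℝ} (hP0 : ∀ x, 0 ≤ P x)
    {M₁ M₂ B₁ B₂ : ℕ} (hB₁ : 0 < B₁) (hB₂ : 0 < B₂) (good : Fin M₁ → Fin M₂ → Prop)
    (e₁ : X → Fin M₁) (e₂ : X → Fin M₂) :
    ∃ (b₁ : Fin M₁ → Fin B₁) (b₂ : Fin M₂ → Fin B₂),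
      ∑ x, P x * ind (∃ i j, (i, j) ≠ (e₁ x, e₂ x) ∧ b₁ i = b₁ (e₁ x) ∧ b₂ j = b₂ (e₂ x) ∧
          good i j) ≤
      ∑ x, P x * ((∑ i, ∑ j, ind (good i j)) * (1 / B₁ * (1 / B₂)) +
        (∑ j, ind (good (e₁ x) j)) * (1 / B₂) +
        (∑ i, ind (good i (e₂ x))) * (1 / B₁)) := by
  set u₁ : (Fin M₁ → Fin B₁) → ℝ := fun _ => ∏ _j : Fin M₁, (1 / (B₁ : ℝ)) with hu₁
  set u₂ : (Fin M₂ → Fin B₂) → ℝ := fun _ => ∏ _j : Fin M₂, (1 / (B₂ : ℝ)) with hu₂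
  have hu₁0 : ∀ b, 0 ≤ u₁ b := fun b => Finset.prod_nonneg fun _ _ => by positivity
  have hu₂0 : ∀ b, 0 ≤ u₂ b := fun b => Finset.prod_nonneg fun _ _ => by positivity
  have hs₁ : ∑ b, u₁ b = 1 :=
    sum_pi_prod_eq_one (w := fun _ : Fin B₁ => 1 / (B₁ : ℝ)) (by
      have : (B₁ : ℝ) ≠ 0 := by positivity
      simp [this])
  have hs₂ : ∑ b, u₂ b = 1 :=
    sum_pi_prod_eq_one (w := fun _ : Fin B₂ => 1 / (B₂ : ℝ)) (by
      have : (B₂ : ℝ) ≠ 0 := by positivity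
      simp [this])
  have hsum : ∑ b : (Fin M₁ → Fin B₁) × (Fin M₂ → Fin B₂), u₁ b.1 * u₂ b.2 = 1 := by
    rw [Fintype.sum_prod_type]
    simp only [← Finset.mul_sum, hs₂, mul_one, hs₁]
  have key : ∃ b : (Fin M₁ → Fin B₁) × (Fin M₂ → Fin B₂),
      ∑ x, P x * ind (∃ i j, (i, j) ≠ (e₁ x, e₂ x) ∧ b.1 i = b.1 (e₁ x) ∧ b.2 j = b.2 (e₂ x) ∧
          good i j) ≤
      ∑ x, P x * ((∑ i, ∑ j, ind (good i j)) * (1 / B₁ * (1 / B₂)) +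
        (∑ j, ind (good (e₁ x) j)) * (1 / B₂) +
        (∑ i, ind (good i (e₂ x))) * (1 / B₁)) := by
    refine exists_le_of_weighted_sum_le (fun b => mul_nonneg (hu₁0 b.1) (hu₂0 b.2)) hsum ?_
    simp_rw [Finset.mul_sum (s := Finset.univ (α := X))]
    rw [Finset.sum_comm]
    refine Finset.sum_le_sum fun x _ => ?_
    have hre : ∀ b : (Fin M₁ → Fin B₁) × (Fin M₂ → Fin B₂), ∀ r : ℝ,
        u₁ b.1 * u₂ b.2 * (P x * r) = P x * (u₁ b.1 * u₂ b.2 * r) := fun b r => by ring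
    simp_rw [hre]
    rw [← Finset.mul_sum]
    refine mul_le_mul_of_nonneg_left ?_ (hP0 x)
    -- A wrong pair errs in both indices, only in the second, or only in the first; each wrong index
    -- costs one collision, of probability `1 / B₁` or `1 / B₂`.
    have hpt : ∀ b : (Fin M₁ → Fin B₁) × (Fin M₂ → Fin B₂),
        ind (∃ i j, (i, j) ≠ (e₁ x, e₂ x) ∧ b.1 i = b.1 (e₁ x) ∧ b.2 j = b.2 (e₂ x) ∧
          good i j) ≤
        (∑ i, ∑ j, ind (good i j) *
          (ind (i ≠ e₁ x ∧ b.1 i = b.1 (e₁ x)) *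
           ind (j ≠ e₂ x ∧ b.2 j = b.2 (e₂ x)))) +
        (∑ j, ind (good (e₁ x) j) *
          ind (j ≠ e₂ x ∧ b.2 j = b.2 (e₂ x))) +
        (∑ i, ind (good i (e₂ x)) *
          ind (i ≠ e₁ x ∧ b.1 i = b.1 (e₁ x))) := by
      intro b
      have hA : ∀ i j, (0 : ℝ) ≤ ind (good i j) *
          (ind (i ≠ e₁ x ∧ b.1 i = b.1 (e₁ x)) *
           ind (j ≠ e₂ x ∧ b.2 j = b.2 (e₂ x))) := by
        intros; simp only [ind_nonneg, mul_nonneg]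
      have hB : ∀ j, (0 : ℝ) ≤ ind (good (e₁ x) j) *
          ind (j ≠ e₂ x ∧ b.2 j = b.2 (e₂ x)) := by
        intros; simp only [ind_nonneg, mul_nonneg]
      have hC : ∀ i, (0 : ℝ) ≤ ind (good i (e₂ x)) *
          ind (i ≠ e₁ x ∧ b.1 i = b.1 (e₁ x)) := by
        intros; simp only [ind_nonneg, mul_nonneg]
      have hA' := Finset.sum_nonneg fun i (_ : i ∈ Finset.univ) =>
        Finset.sum_nonneg fun j (_ : j ∈ Finset.univ) => hA i j
      have hB' := Finset.sum_nonneg fun j (_ : j ∈ Finset.univ) => hB j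
      have hC' := Finset.sum_nonneg fun i (_ : i ∈ Finset.univ) => hC i
      by_cases h : ∃ i j, (i, j) ≠ (e₁ x, e₂ x) ∧ b.1 i = b.1 (e₁ x) ∧ b.2 j = b.2 (e₂ x) ∧
          good i j
      · rw [ind_of h]
        obtain ⟨i, j, hne, h1, h2, hg⟩ := h
        by_cases hi : i = e₁ x
        · by_cases hj : j = e₂ x
          · exact absurd (by rw [hi, hj]) hne
          · subst hi
            have := Finset.single_le_sum (fun j (_ : j ∈ Finset.univ) => hB j) (Finset.mem_univ j)
            rw [ind_of hg, ind_of ⟨hj, h2⟩, mul_one] at this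
            linarith
        · by_cases hj : j = e₂ x
          · subst hj
            have := Finset.single_le_sum (fun i (_ : i ∈ Finset.univ) => hC i) (Finset.mem_univ i)
            rw [ind_of hg, ind_of ⟨hi, h1⟩, mul_one] at this
            linarith
          · have h3 := Finset.single_le_sum (fun j (_ : j ∈ Finset.univ) => hA i j)
              (Finset.mem_univ j)
            have h4 := Finset.single_le_sum (f := fun i => ∑ j, ind (good i j) *
              (ind (i ≠ e₁ x ∧ b.1 i = b.1 (e₁ x)) *
              ind (j ≠ e₂ x ∧ b.2 j = b.2 (e₂ x)))) (fun i (_ : i ∈ Finset.univ) =>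
              Finset.sum_nonneg fun j (_ : j ∈ Finset.univ) => hA i j) (Finset.mem_univ i)
            have h5 : ind (good i j) * (ind (i ≠ e₁ x ∧ b.1 i = b.1 (e₁ x)) *
                ind (j ≠ e₂ x ∧ b.2 j = b.2 (e₂ x))) = 1 := by
              rw [ind_of hg, ind_of ⟨hi, h1⟩, ind_of ⟨hj, h2⟩, mul_one, mul_one]
            rw [h5] at h3
            linarith
      · rw [ind_of_not h]
        linarith
    have hm₁ : ∀ i, ∑ b, u₁ b * ind (i ≠ e₁ x ∧ b i = b (e₁ x)) ≤ 1 / (B₁ : ℝ) := by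
      intro i
      by_cases hi : i = e₁ x
      · simp [hi]
      · simp only [ne_eq, hi, not_false_eq_true, true_and]
        exact (sum_uniform_collision hB₁ hi).le
    have hm₂ : ∀ j, ∑ b, u₂ b * ind (j ≠ e₂ x ∧ b j = b (e₂ x)) ≤ 1 / (B₂ : ℝ) := by
      intro j
      by_cases hj : j = e₂ x
      · simp [hj]
      · simp only [ne_eq, hj, not_false_eq_true, true_and]
        exact (sum_uniform_collision hB₂ hj).le
    have hprod : ∀ (F₁ : (Fin M₁ → Fin B₁) → ℝ) (F₂ : (Fin M₂ → Fin B₂) → ℝ),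
        ∑ b : (Fin M₁ → Fin B₁) × (Fin M₂ → Fin B₂), u₁ b.1 * u₂ b.2 * (F₁ b.1 * F₂ b.2)
        = (∑ b, u₁ b * F₁ b) * ∑ b, u₂ b * F₂ b := by
      intro F₁ F₂
      rw [Fintype.sum_prod_type, Finset.sum_mul_sum]
      refine Finset.sum_congr rfl fun a _ => Finset.sum_congr rfl fun b _ => ?_
      ring
    have hprod₁ : ∀ (F₁ : (Fin M₁ → Fin B₁) → ℝ),
        ∑ b : (Fin M₁ → Fin B₁) × (Fin M₂ → Fin B₂), u₁ b.1 * u₂ b.2 * F₁ b.1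
        = ∑ b, u₁ b * F₁ b := by
      intro F₁
      have := hprod F₁ (fun _ => 1)
      simpa [hs₂] using this
    have hprod₂ : ∀ (F₂ : (Fin M₂ → Fin B₂) → ℝ),
        ∑ b : (Fin M₁ → Fin B₁) × (Fin M₂ → Fin B₂), u₁ b.1 * u₂ b.2 * F₂ b.2
        = ∑ b, u₂ b * F₂ b := by
      intro F₂
      have := hprod (fun _ => 1) F₂
      simpa [hs₁] using this
    refine (Finset.sum_le_sum fun b _ => mul_le_mul_of_nonneg_left (hpt b)
      (mul_nonneg (hu₁0 b.1) (hu₂0 b.2))).trans ?_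
    simp_rw [mul_add]
    rw [Finset.sum_add_distrib, Finset.sum_add_distrib]
    refine add_le_add (add_le_add ?_ ?_) ?_
    · simp_rw [Finset.mul_sum]
      rw [Finset.sum_comm, Finset.sum_mul]
      refine Finset.sum_le_sum fun i _ => ?_
      rw [Finset.sum_comm, Finset.sum_mul]
      refine Finset.sum_le_sum fun j _ => ?_
      simp_rw [mul_left_comm _ (ind (good i j))]
      rw [← Finset.mul_sum]
      refine mul_le_mul_of_nonneg_left ?_ (ind_nonneg _)
      rw [hprod (fun b => ind (i ≠ e₁ x ∧ b i = b (e₁ x)))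
        (fun b => ind (j ≠ e₂ x ∧ b j = b (e₂ x)))]
      exact mul_le_mul (hm₁ i) (hm₂ j)
        (Finset.sum_nonneg fun b _ => mul_nonneg (hu₂0 b) (ind_nonneg _)) (by positivity)
    · simp_rw [Finset.mul_sum]
      rw [Finset.sum_comm, Finset.sum_mul]
      refine Finset.sum_le_sum fun j _ => ?_
      simp_rw [mul_left_comm _ (ind (good (e₁ x) j))]
      rw [← Finset.mul_sum]
      refine mul_le_mul_of_nonneg_left ?_ (ind_nonneg _)
      rw [hprod₂ (fun b => ind (j ≠ e₂ x ∧ b j = b (e₂ x)))]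
      exact hm₂ j
    · simp_rw [Finset.mul_sum]
      rw [Finset.sum_comm, Finset.sum_mul]
      refine Finset.sum_le_sum fun i _ => ?_
      simp_rw [mul_left_comm _ (ind (good i (e₂ x)))]
      rw [← Finset.mul_sum]
      refine mul_le_mul_of_nonneg_left ?_ (ind_nonneg _)
      rw [hprod₁ (fun b => ind (i ≠ e₁ x ∧ b i = b (e₁ x)))]
      exact hm₁ i
  obtain ⟨b, hb⟩ := key
  exact ⟨b.1, b.2, hb⟩

/-! ### One-shot codes from codebooks and bins. -/

/-- Replacing subchannels `V₁, V₂` by channels that dominate them up to factors `c₁, c₂`. -/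
theorem sum_subchannel_le {Z₁ Z₂ : Type*} [Fintype Z₁] [Fintype Z₂] {V₁ W₁ : Z₁ → ℝ}
    {V₂ W₂ : Z₂ → ℝ} {c₁ c₂ F : ℝ} (hV₁ : ∀ z, 0 ≤ V₁ z) (hV₂ : ∀ z, 0 ≤ V₂ z)
    (hs₁ : ∑ z, V₁ z ≤ 1) (hs₂ : ∑ z, V₂ z ≤ 1) (h₁ : ∀ z, V₁ z * c₁ ≤ W₁ z)
    (h₂ : ∀ z, V₂ z * c₂ ≤ W₂ z) (hW₁ : ∀ z, 0 ≤ W₁ z)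
    (hc₁1 : c₁ ≤ 1) (hc₂0 : 0 ≤ c₂) (hc₂1 : c₂ ≤ 1) {f : Z₁ × Z₂ → ℝ} (hf0 : ∀ z, 0 ≤ f z)
    (hfF : ∀ z, f z ≤ F) (hF : 0 ≤ F) :
    ∑ z : Z₁ × Z₂, V₁ z.1 * V₂ z.2 * f z ≤
      ∑ z : Z₁ × Z₂, W₁ z.1 * W₂ z.2 * f z + F * ((1 - c₁) + (1 - c₂)) := by
  have hpt : ∀ z : Z₁ × Z₂, V₁ z.1 * V₂ z.2 * f z ≤
      W₁ z.1 * W₂ z.2 * f z + V₁ z.1 * V₂ z.2 * (F * ((1 - c₁) + (1 - c₂))) := by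
    intro z
    have hv : 0 ≤ V₁ z.1 * V₂ z.2 := mul_nonneg (hV₁ _) (hV₂ _)
    have h3 : (V₁ z.1 * c₁) * (V₂ z.2 * c₂) ≤ W₁ z.1 * W₂ z.2 :=
      mul_le_mul (h₁ _) (h₂ _) (mul_nonneg (hV₂ _) hc₂0) (hW₁ _)
    -- From `(1 - c₁) * (1 - c₂) ≥ 0` one gets `1 - c₁ * c₂ ≤ (1 - c₁) + (1 - c₂)`; no division by
    -- `c₁` or `c₂` is needed.
    have h4 : V₁ z.1 * V₂ z.2 ≤ W₁ z.1 * W₂ z.2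
        + V₁ z.1 * V₂ z.2 * ((1 - c₁) + (1 - c₂)) := by
      nlinarith [mul_nonneg hv (mul_nonneg (sub_nonneg.2 hc₁1) (sub_nonneg.2 hc₂1))]
    have h5 := mul_le_mul_of_nonneg_right h4 (hf0 z)
    have h6 : V₁ z.1 * V₂ z.2 * ((1 - c₁) + (1 - c₂)) * f z ≤
        V₁ z.1 * V₂ z.2 * ((1 - c₁) + (1 - c₂)) * F :=
      mul_le_mul_of_nonneg_left (hfF z) (mul_nonneg hv (by linarith))
    linarith
  refine (Finset.sum_le_sum fun z _ => hpt z).trans ?_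
  rw [Finset.sum_add_distrib, ← Finset.sum_mul]
  have hs : ∑ z : Z₁ × Z₂, V₁ z.1 * V₂ z.2 ≤ 1 := by
    rw [Fintype.sum_prod_type, ← Finset.sum_mul_sum]
    exact mul_le_one₀ hs₁ (Finset.sum_nonneg fun z _ => hV₂ z) hs₂
  have := mul_le_mul_of_nonneg_right hs
    (mul_nonneg hF (by linarith : 0 ≤ (1 - c₁) + (1 - c₂)))
  linarith

/-- A decoder recovering an admissible pair of indices from its pair of bins whenever no other
admissible pair shares these bins. -/
theorem exists_bin_decoder {ι₁ ι₂ β₁ β₂ : Type*} [Nonempty ι₁] [Nonempty ι₂]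
    (good : ι₁ → ι₂ → Prop) (b₁ : ι₁ → β₁) (b₂ : ι₂ → β₂) :
    ∃ dec : β₁ × β₂ → ι₁ × ι₂, ∀ i j, good i j →
      (¬ ∃ i' j', (i', j') ≠ (i, j) ∧ b₁ i' = b₁ i ∧ b₂ j' = b₂ j ∧ good i' j') →
      dec (b₁ i, b₂ j) = (i, j) := by
  have h : ∀ b : β₁ × β₂, ∃ k : ι₁ × ι₂,
      (∃ k : ι₁ × ι₂, b₁ k.1 = b.1 ∧ b₂ k.2 = b.2 ∧ good k.1 k.2) →
        b₁ k.1 = b.1 ∧ b₂ k.2 = b.2 ∧ good k.1 k.2 := by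
    intro b
    by_cases h : ∃ k : ι₁ × ι₂, b₁ k.1 = b.1 ∧ b₂ k.2 = b.2 ∧ good k.1 k.2
    · obtain ⟨k, hk⟩ := h
      exact ⟨k, fun _ => hk⟩
    · exact ⟨Classical.arbitrary _, fun h' => absurd h' h⟩
  choose dec hdec using h
  refine ⟨dec, fun i j hg hu => ?_⟩
  have h1 := hdec (b₁ i, b₂ j) ⟨(i, j), rfl, rfl, hg⟩
  by_contra hne
  exact hu ⟨_, _, hne, h1⟩

/-- The law of a randomly selected word, on the event that the selection succeeds. -/
theorem sum_selection_le_one {T Z : Type*} [Fintype T] [Fintype Z] {w : T → ℝ}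
    (hw0 : ∀ t, 0 ≤ w t) (hw : ∑ t, w t = 1) (found : T → Prop) (u : T → Z) :
    ∑ z, ∑ t, w t * ind (found t ∧ u t = z) ≤ 1 := by
  rw [Finset.sum_comm, ← hw]
  refine Finset.sum_le_sum fun t _ => ?_
  rw [← Finset.mul_sum]
  refine mul_le_of_le_one_right (hw0 t) ?_
  calc _ ≤ ∑ z, ind (u t = z) :=
        Finset.sum_le_sum fun z _ => ind_mono fun h => h.2
    _ = 1 := by simp [ind_eq]

set_option maxHeartbeats 1600000 in
/-- One-shot achievability by random codebooks, given the performance of the selection of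
codewords: random binning, and decoding to the unique admissible pair of words. -/
theorem exists_code_of_random_codebooks {T₁ T₂ X₁ X₂ Z₁ Z₂ : Type*} [Fintype X₁] [Fintype X₂]
    [Fintype Z₁] [Fintype Z₂] [Fintype T₁] [Fintype T₂] {P : X₁ × X₂ → ℝ} (hP0 : ∀ x, 0 ≤ P x)
    (hP1 : ∑ x, P x = 1) {p₁ : Z₁ → ℝ} {p₂ : Z₂ → ℝ} (hp₂0 : ∀ z, 0 ≤ p₂ z)
    {W₁ : X₁ → Z₁ → ℝ} (hW₁0 : ∀ x z, 0 ≤ W₁ x z) (hW₁ : ∀ x, ∑ z, W₁ x z ≤ 1)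
    {W₂ : X₂ → Z₂ → ℝ} (hW₂0 : ∀ x z, 0 ≤ W₂ x z) (hW₂ : ∀ x, ∑ z, W₂ x z ≤ 1)
    {K₁ K₂ : ℝ} (hK₂ : 0 < K₂) {M₁ M₂ B₁ B₂ : ℕ} (hM₁ : 0 < M₁) (hM₂ : 0 < M₂)
    (hB₁ : 0 < B₁) (hB₂ : 0 < B₂) (good : Z₁ → Z₂ → Prop) {g : ℝ}
    (hg₁ : ∀ z₁, ∑ z₂, p₂ z₂ * ind (good z₁ z₂) ≤ g)
    (hg₂ : ∀ z₂, ∑ z₁, p₁ z₁ * ind (good z₁ z₂) ≤ g)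
    {w₁ : T₁ → ℝ} {u₁ : T₁ → Fin M₁ → Z₁} {e₁ : T₁ → X₁ → Fin M₁}
    {fd₁ : T₁ → X₁ → Prop} (hw₁0 : ∀ t, 0 ≤ w₁ t) (hw₁ : ∑ t, w₁ t = 1)
    (hm₁ : ∀ i (f : Z₁ → ℝ), ∑ t, w₁ t * f (u₁ t i) = ∑ z, p₁ z * f z)
    (hV₁ : ∀ x z, (∑ t, w₁ t * ind (fd₁ t x ∧ u₁ t (e₁ t x) = z)) *
        (∑ z, min (K₁ * p₁ z) (W₁ x z)) ≤ W₁ x z)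
    (hn₁ : ∀ x, ∑ t, w₁ t * ind (¬ fd₁ t x) ≤
        (1 - ∑ z, min (K₁ * p₁ z) (W₁ x z)) + Real.exp (-(M₁ / K₁)))
    {w₂ : T₂ → ℝ} {u₂ : T₂ → Fin M₂ → Z₂} {e₂ : T₂ → X₂ → Fin M₂}
    {fd₂ : T₂ → X₂ → Prop} (hw₂0 : ∀ t, 0 ≤ w₂ t) (hw₂ : ∑ t, w₂ t = 1)
    (hm₂ : ∀ i (f : Z₂ → ℝ), ∑ t, w₂ t * f (u₂ t i) = ∑ z, p₂ z * f z)
    (hV₂ : ∀ x z, (∑ t, w₂ t * ind (fd₂ t x ∧ u₂ t (e₂ t x) = z)) *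
        (∑ z, min (K₂ * p₂ z) (W₂ x z)) ≤ W₂ x z)
    (hn₂ : ∀ x, ∑ t, w₂ t * ind (¬ fd₂ t x) ≤
        (1 - ∑ z, min (K₂ * p₂ z) (W₂ x z)) + Real.exp (-(M₂ / K₂)))
    {d : X₁ × X₂ → Z₁ × Z₂ → ℝ} {D₀ : ℝ} (hd0 : ∀ x z, 0 ≤ d x z) (hd : ∀ x z, d x z ≤ D₀)
    (hD₀ : 0 ≤ D₀) :
    ∃ (φ₁ : X₁ → Fin B₁) (φ₂ : X₂ → Fin B₂) (dec : Fin B₁ × Fin B₂ → Z₁ × Z₂),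
      ∑ x, P x * d x (dec (φ₁ x.1, φ₂ x.2)) ≤
        ∑ x, P x * (∑ z : Z₁ × Z₂, W₁ x.1 z.1 * W₂ x.2 z.2 *
          (d x z + D₀ * ind (¬ good z.1 z.2))) +
        D₀ * (3 * ∑ x, P x * (1 - ∑ z, min (K₁ * p₁ z) (W₁ x.1 z)) +
          3 * ∑ x, P x * (1 - ∑ z, min (K₂ * p₂ z) (W₂ x.2 z)) +
          Real.exp (-(M₁ / K₁)) + Real.exp (-(M₂ / K₂)) +
          M₁ * M₂ * g / (B₁ * B₂) + M₂ * g / B₂ + M₁ * g / B₁) := by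
  set c₁ : X₁ → ℝ := fun x => ∑ z, min (K₁ * p₁ z) (W₁ x z) with hc₁
  set c₂ : X₂ → ℝ := fun x => ∑ z, min (K₂ * p₂ z) (W₂ x z) with hc₂
  have hc₂0 : ∀ x, 0 ≤ c₂ x := fun x => Finset.sum_nonneg fun z _ =>
    le_min (mul_nonneg hK₂.le (hp₂0 z)) (hW₂0 x z)
  have hc₁1 : ∀ x, c₁ x ≤ 1 := fun x =>
    (Finset.sum_le_sum fun z _ => min_le_right _ _).trans (hW₁ x)
  have hc₂1 : ∀ x, c₂ x ≤ 1 := fun x =>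
    (Finset.sum_le_sum fun z _ => min_le_right _ _).trans (hW₂ x)
  -- The penalty charges the selection of an inadmissible pair, so one change of law handles
  -- distortion and typicality together. It raises the bound from `D₀` to `2 * D₀`.
  set f : X₁ × X₂ → Z₁ × Z₂ → ℝ := fun x z => d x z + D₀ * ind (¬ good z.1 z.2) with hf
  have hf0 : ∀ x z, 0 ≤ f x z := fun x z =>
    add_nonneg (hd0 x z) (mul_nonneg hD₀ (ind_nonneg _))
  have hfF : ∀ x z, f x z ≤ 2 * D₀ := fun x z => by
    have h1 := hd x z
    have h2 := mul_le_of_le_one_right hD₀ (ind_le_one (¬ good z.1 z.2))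
    simp only [hf]; linarith
  -- The value of `f` at the selected words, zero if a selection fails. Written as a sum over `z`,
  -- it factorizes when averaged over independent codebooks.
  set hit : T₁ × T₂ → X₁ × X₂ → ℝ :=
    fun t x => ∑ z : Z₁ × Z₂, ind (fd₁ t.1 x.1 ∧ u₁ t.1 (e₁ t.1 x.1) = z.1) *
      ind (fd₂ t.2 x.2 ∧ u₂ t.2 (e₂ t.2 x.2) = z.2) * f x z with hhit
  set coll : T₁ × T₂ → X₁ × X₂ → ℝ :=
    fun t x => (∑ i, ∑ j, ind (good (u₁ t.1 i) (u₂ t.2 j))) * (1 / B₁ * (1 / B₂)) +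
        (∑ j, ind (good (u₁ t.1 (e₁ t.1 x.1)) (u₂ t.2 j))) * (1 / B₂) +
        (∑ i, ind (good (u₁ t.1 i) (u₂ t.2 (e₂ t.2 x.2)))) * (1 / B₁) with hcoll
  have hprod : ∀ (F₁ : T₁ → ℝ) (F₂ : T₂ → ℝ),
      ∑ t : T₁ × T₂,
        w₁ t.1 * w₂ t.2 * (F₁ t.1 * F₂ t.2) = (∑ t, w₁ t * F₁ t) * ∑ t, w₂ t * F₂ t := by
    intro F₁ F₂
    rw [Fintype.sum_prod_type, Finset.sum_mul_sum]
    refine Finset.sum_congr rfl fun a _ => Finset.sum_congr rfl fun b _ => ?_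
    ring
  have hsum : ∑ t : T₁ × T₂,
      w₁ t.1 * w₂ t.2 = 1 := by
    simpa [hw₁, hw₂] using hprod (fun _ => 1) (fun _ => 1)
  have hwt0 : ∀ t : T₁ × T₂,
      0 ≤ w₁ t.1 * w₂ t.2 := fun t => mul_nonneg (hw₁0 _) (hw₂0 _)
  -- the average of each error term over the codebooks
  have hA : ∀ x, ∑ t, w₁ t.1 * w₂ t.2 * hit t x ≤
      ∑ z : Z₁ × Z₂, W₁ x.1 z.1 * W₂ x.2 z.2 * f x z +
        2 * D₀ * ((1 - c₁ x.1) + (1 - c₂ x.2)) := by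
    intro x
    have h1 := sum_subchannel_le (f := f x) (F := 2 * D₀)
      (V₁ := fun z => ∑ t, w₁ t * ind (fd₁ t x.1 ∧ u₁ t (e₁ t x.1) = z))
      (V₂ := fun z => ∑ t, w₂ t * ind (fd₂ t x.2 ∧ u₂ t (e₂ t x.2) = z))
      (fun z => Finset.sum_nonneg fun t _ => mul_nonneg (hw₁0 t) (ind_nonneg _))
      (fun z => Finset.sum_nonneg fun t _ => mul_nonneg (hw₂0 t) (ind_nonneg _))
      (sum_selection_le_one hw₁0 hw₁ (fun t => fd₁ t x.1) (fun t => u₁ t (e₁ t x.1)))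
      (sum_selection_le_one hw₂0 hw₂ (fun t => fd₂ t x.2) (fun t => u₂ t (e₂ t x.2)))
      (hV₁ x.1) (hV₂ x.2) (hW₁0 x.1) (hc₁1 x.1) (hc₂0 x.2) (hc₂1 x.2) (hf0 x) (hfF x)
      (by linarith)
    refine le_trans (le_of_eq ?_) h1
    simp_rw [hhit, Finset.mul_sum (s := Finset.univ (α := Z₁ × Z₂))]
    rw [Finset.sum_comm]
    refine Finset.sum_congr rfl fun z _ => ?_
    rw [← hprod (fun t => ind (fd₁ t x.1 ∧ u₁ t (e₁ t x.1) = z.1))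
      (fun t => ind (fd₂ t x.2 ∧ u₂ t (e₂ t x.2) = z.2)), Finset.sum_mul]
    exact Finset.sum_congr rfl fun t _ => (mul_assoc _ _ _).symm
  have hN₁ : ∀ x : X₁ × X₂, ∑ t : T₁ × T₂,
      w₁ t.1 * w₂ t.2 * ind (¬ fd₁ t.1 x.1) ≤ (1 - c₁ x.1) + Real.exp (-(M₁ / K₁)) := by
    intro x
    have := hprod (fun t => ind (¬ fd₁ t x.1)) (fun _ => 1)
    simp only [mul_one, hw₂] at this
    rw [this]; exact hn₁ x.1
  have hN₂ : ∀ x : X₁ × X₂, ∑ t : T₁ × T₂,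
      w₁ t.1 * w₂ t.2 * ind (¬ fd₂ t.2 x.2) ≤ (1 - c₂ x.2) + Real.exp (-(M₂ / K₂)) := by
    intro x
    have := hprod (fun _ => 1) (fun t => ind (¬ fd₂ t x.2))
    simp only [mul_one, one_mul, hw₁] at this
    rw [this]; exact hn₂ x.2
  have hG₂ : ∀ z : Z₁, ∑ t, w₂ t * ∑ j, ind (good z (u₂ t j)) ≤ M₂ * g := by
    intro z
    simp_rw [Finset.mul_sum]
    rw [Finset.sum_comm]
    refine (Finset.sum_le_sum fun j _ =>
      ((hm₂ j (fun z₂ => ind (good z z₂))).le.trans (hg₁ z))).trans (le_of_eq ?_)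
    simp
  have hG₁ : ∀ z : Z₂, ∑ t, w₁ t * ∑ i, ind (good (u₁ t i) z) ≤ M₁ * g := by
    intro z
    simp_rw [Finset.mul_sum]
    rw [Finset.sum_comm]
    refine (Finset.sum_le_sum fun j _ =>
      ((hm₁ j (fun z₁ => ind (good z₁ z))).le.trans (hg₂ z))).trans (le_of_eq ?_)
    simp
  have hsplit : ∀ F : T₁ × T₂ → ℝ,
      ∑ t, w₁ t.1 * w₂ t.2 * F t = ∑ a, w₁ a * ∑ b, w₂ b * F (a, b) := by
    intro F
    rw [Fintype.sum_prod_type]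
    refine Finset.sum_congr rfl fun a _ => ?_
    rw [Finset.mul_sum]
    refine Finset.sum_congr rfl fun b _ => ?_
    ring
  have hsplit' : ∀ F : T₁ × T₂ → ℝ,
      ∑ t, w₁ t.1 * w₂ t.2 * F t = ∑ b, w₂ b * ∑ a, w₁ a * F (a, b) := by
    intro F
    rw [Fintype.sum_prod_type_right]
    refine Finset.sum_congr rfl fun a _ => ?_
    rw [Finset.mul_sum]
    refine Finset.sum_congr rfl fun b _ => ?_
    ring
  have hmean₁ : ∀ {F : T₁ → ℝ} {C : ℝ}, (∀ a, F a ≤ C) →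
      ∑ a, w₁ a * F a ≤ C := by
    intro F C h
    calc _ ≤ ∑ a, w₁ a * C :=
          Finset.sum_le_sum fun a _ => mul_le_mul_of_nonneg_left (h a) (hw₁0 a)
      _ = C := by rw [← Finset.sum_mul, hw₁, one_mul]
  have hmean₂ : ∀ {F : T₂ → ℝ} {C : ℝ}, (∀ a, F a ≤ C) →
      ∑ a, w₂ a * F a ≤ C := by
    intro F C h
    calc _ ≤ ∑ a, w₂ a * C :=
          Finset.sum_le_sum fun a _ => mul_le_mul_of_nonneg_left (h a) (hw₂0 a)
      _ = C := by rw [← Finset.sum_mul, hw₂, one_mul]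
  have hC : ∀ x, ∑ t, w₁ t.1 * w₂ t.2 * coll t x ≤
      M₁ * M₂ * g / (B₁ * B₂) + M₂ * g / B₂ + M₁ * g / B₁ := by
    intro x
    simp_rw [hcoll, mul_add, Finset.sum_add_distrib, ← mul_assoc _ _ (1 / (B₁ : ℝ) * (1 / (B₂ : ℝ))),
      ← mul_assoc _ _ (1 / (B₂ : ℝ)), ← mul_assoc _ _ (1 / (B₁ : ℝ))]
    simp_rw [← Finset.sum_mul]
    have h1 : ∑ t : T₁ × T₂,
        w₁ t.1 * w₂ t.2 * (∑ i, ∑ j, ind (good (u₁ t.1 i) (u₂ t.2 j))) ≤ M₁ * M₂ * g := by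
      rw [hsplit]
      refine hmean₁ fun a => ?_
      simp_rw [Finset.mul_sum _ (fun i => ∑ j, ind (good (u₁ a i) _))]
      rw [Finset.sum_comm]
      refine (Finset.sum_le_sum fun i _ => hG₂ (u₁ a i)).trans (le_of_eq ?_)
      simp [mul_assoc]
    have h2 : ∑ t : T₁ × T₂,
        w₁ t.1 * w₂ t.2 * (∑ j, ind (good (u₁ t.1 (e₁ t.1 x.1)) (u₂ t.2 j))) ≤ M₂ * g := by
      rw [hsplit]
      -- With the first codebook fixed, its selected word is a constant and the second codebook is
      -- still fresh.
      exact hmean₁ fun a => hG₂ (u₁ a (e₁ a x.1))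
    have h3 : ∑ t : T₁ × T₂,
        w₁ t.1 * w₂ t.2 * (∑ i, ind (good (u₁ t.1 i) (u₂ t.2 (e₂ t.2 x.2)))) ≤ M₁ * g := by
      rw [hsplit']
      exact hmean₂ fun a => hG₁ (u₂ a (e₂ a x.2))
    have e1 : M₁ * M₂ * g / (B₁ * B₂) = M₁ * M₂ * g * (1 / (B₁ : ℝ)) * (1 / (B₂ : ℝ)) := by
      field_simp
    rw [e1, div_eq_mul_one_div (M₂ * g), div_eq_mul_one_div (M₁ * g)]
    exact add_le_add (add_le_add (mul_le_mul_of_nonneg_right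
      (mul_le_mul_of_nonneg_right h1 (by positivity : (0 : ℝ) ≤ 1 / B₁))
      (by positivity : (0 : ℝ) ≤ 1 / B₂))
      (mul_le_mul_of_nonneg_right h2 (by positivity : (0 : ℝ) ≤ 1 / B₂)))
      (mul_le_mul_of_nonneg_right h3 (by positivity : (0 : ℝ) ≤ 1 / B₁))
  -- Codebooks are fixed before bins: `coll` is already averaged over binnings. In the factor `3`,
  -- two units come from the bound `2 * D₀` on `f` and one from failed selection.
  have hex : ∃ t, ∑ x, P x * (hit t x + D₀ * ind (¬ fd₁ t.1 x.1) + D₀ * ind (¬ fd₂ t.2 x.2) +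
      D₀ * coll t x) ≤ ∑ x, P x * (∑ z : Z₁ × Z₂, W₁ x.1 z.1 * W₂ x.2 z.2 * f x z) +
        D₀ * (3 * ∑ x, P x * (1 - c₁ x.1) + 3 * ∑ x, P x * (1 - c₂ x.2) +
          Real.exp (-(M₁ / K₁)) + Real.exp (-(M₂ / K₂)) +
          M₁ * M₂ * g / (B₁ * B₂) + M₂ * g / B₂ + M₁ * g / B₁) := by
    refine exists_le_of_weighted_sum_le hwt0 hsum ?_
    set E := Real.exp (-(M₁ / K₁)) + Real.exp (-(M₂ / K₂)) +
          M₁ * M₂ * g / (B₁ * B₂) + M₂ * g / B₂ + M₁ * g / B₁ with hE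
    have hR : ∑ x, P x * (∑ z : Z₁ × Z₂, W₁ x.1 z.1 * W₂ x.2 z.2 * f x z) +
        D₀ * (3 * ∑ x, P x * (1 - c₁ x.1) + 3 * ∑ x, P x * (1 - c₂ x.2) +
          Real.exp (-(M₁ / K₁)) + Real.exp (-(M₂ / K₂)) +
          M₁ * M₂ * g / (B₁ * B₂) + M₂ * g / B₂ + M₁ * g / B₁) =
        ∑ x, P x * ((∑ z : Z₁ × Z₂, W₁ x.1 z.1 * W₂ x.2 z.2 * f x z) +
          D₀ * (3 * (1 - c₁ x.1) + 3 * (1 - c₂ x.2) + E)) := by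
      have : ∀ x, P x * ((∑ z : Z₁ × Z₂, W₁ x.1 z.1 * W₂ x.2 z.2 * f x z) +
          D₀ * (3 * (1 - c₁ x.1) + 3 * (1 - c₂ x.2) + E)) =
          P x * (∑ z : Z₁ × Z₂, W₁ x.1 z.1 * W₂ x.2 z.2 * f x z) +
          D₀ * 3 * (P x * (1 - c₁ x.1)) + D₀ * 3 * (P x * (1 - c₂ x.2)) + P x * (D₀ * E) := by
        intro x; ring
      simp_rw [this, Finset.sum_add_distrib, ← Finset.mul_sum, ← Finset.sum_mul, hP1]
      ring
    rw [hR]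
    simp_rw [Finset.mul_sum (s := Finset.univ (α := X₁ × X₂))]
    rw [Finset.sum_comm]
    refine Finset.sum_le_sum fun x _ => ?_
    have hre : ∀ (t : T₁ × T₂),
        w₁ t.1 * w₂ t.2 * (P x * (hit t x + D₀ * ind (¬ fd₁ t.1 x.1) +
          D₀ * ind (¬ fd₂ t.2 x.2) + D₀ * coll t x)) =
        P x * (w₁ t.1 * w₂ t.2 * hit t x + D₀ * (w₁ t.1 * w₂ t.2 * ind (¬ fd₁ t.1 x.1)) +
          D₀ * (w₁ t.1 * w₂ t.2 * ind (¬ fd₂ t.2 x.2)) + D₀ * (w₁ t.1 * w₂ t.2 * coll t x)) :=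
      fun t => by ring
    simp_rw [hre]
    rw [← Finset.mul_sum]
    refine mul_le_mul_of_nonneg_left ?_ (hP0 x)
    simp_rw [Finset.sum_add_distrib, ← Finset.mul_sum]
    have a1 := hA x
    have a2 := mul_le_mul_of_nonneg_left (hN₁ x) hD₀
    have a3 := mul_le_mul_of_nonneg_left (hN₂ x) hD₀
    have a4 := mul_le_mul_of_nonneg_left (hC x) hD₀
    rw [hE]
    nlinarith [a1, a2, a3, a4]
  obtain ⟨t, ht⟩ := hex
  obtain ⟨b₁, b₂, hb⟩ := exists_binning hP0 hB₁ hB₂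
    (fun i j => good (u₁ t.1 i) (u₂ t.2 j)) (fun x => e₁ t.1 x.1) (fun x => e₂ t.2 x.2)
  have : Nonempty (Fin M₁) := ⟨⟨0, hM₁⟩⟩
  have : Nonempty (Fin M₂) := ⟨⟨0, hM₂⟩⟩
  obtain ⟨dec, hdec⟩ := exists_bin_decoder (fun i j => good (u₁ t.1 i) (u₂ t.2 j)) b₁ b₂
  refine ⟨fun x => b₁ (e₁ t.1 x), fun x => b₂ (e₂ t.2 x),
    fun b => (u₁ t.1 (dec b).1, u₂ t.2 (dec b).2), le_trans ?_ ht⟩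
  set bad : X₁ × X₂ → Prop := fun x => ∃ i j, (i, j) ≠ (e₁ t.1 x.1, e₂ t.2 x.2) ∧
    b₁ i = b₁ (e₁ t.1 x.1) ∧ b₂ j = b₂ (e₂ t.2 x.2) ∧ good (u₁ t.1 i) (u₂ t.2 j) with hbad
  have hhit0 : ∀ x, 0 ≤ hit t x := fun x => Finset.sum_nonneg fun z _ =>
    mul_nonneg (mul_nonneg (ind_nonneg _) (ind_nonneg _)) (hf0 x z)
  -- If both selections succeed and no rival pair exists, an admissible selected pair is decoded
  -- correctly, while for an inadmissible one `hit` is already at least `D₀`.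
  have hpt : ∀ x, d x (u₁ t.1 (dec (b₁ (e₁ t.1 x.1), b₂ (e₂ t.2 x.2))).1,
      u₂ t.2 (dec (b₁ (e₁ t.1 x.1), b₂ (e₂ t.2 x.2))).2) ≤
      hit t x + D₀ * ind (¬ fd₁ t.1 x.1) + D₀ * ind (¬ fd₂ t.2 x.2) + D₀ * ind (bad x) := by
    intro x
    have h0 := hhit0 x
    have i1 := mul_nonneg hD₀ (ind_nonneg (¬ fd₁ t.1 x.1))
    have i2 := mul_nonneg hD₀ (ind_nonneg (¬ fd₂ t.2 x.2))
    have i3 := mul_nonneg hD₀ (ind_nonneg (bad x))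
    by_cases h1 : fd₁ t.1 x.1
    swap
    · have := hd x (u₁ t.1 (dec (b₁ (e₁ t.1 x.1), b₂ (e₂ t.2 x.2))).1,
        u₂ t.2 (dec (b₁ (e₁ t.1 x.1), b₂ (e₂ t.2 x.2))).2)
      rw [ind_of h1] at *; linarith
    by_cases h2 : fd₂ t.2 x.2
    swap
    · have := hd x (u₁ t.1 (dec (b₁ (e₁ t.1 x.1), b₂ (e₂ t.2 x.2))).1,
        u₂ t.2 (dec (b₁ (e₁ t.1 x.1), b₂ (e₂ t.2 x.2))).2)
      rw [ind_of h2] at *; linarith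
    by_cases h3 : bad x
    · have := hd x (u₁ t.1 (dec (b₁ (e₁ t.1 x.1), b₂ (e₂ t.2 x.2))).1,
        u₂ t.2 (dec (b₁ (e₁ t.1 x.1), b₂ (e₂ t.2 x.2))).2)
      rw [ind_of h3] at *; linarith
    have hle : f x (u₁ t.1 (e₁ t.1 x.1), u₂ t.2 (e₂ t.2 x.2)) ≤ hit t x := by
      have : ind (fd₁ t.1 x.1 ∧ u₁ t.1 (e₁ t.1 x.1) = u₁ t.1 (e₁ t.1 x.1)) *
          ind (fd₂ t.2 x.2 ∧ u₂ t.2 (e₂ t.2 x.2) = u₂ t.2 (e₂ t.2 x.2)) *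
          f x (u₁ t.1 (e₁ t.1 x.1), u₂ t.2 (e₂ t.2 x.2)) ≤ hit t x :=
        Finset.single_le_sum (f := fun z : Z₁ × Z₂ =>
        ind (fd₁ t.1 x.1 ∧ u₁ t.1 (e₁ t.1 x.1) = z.1) *
        ind (fd₂ t.2 x.2 ∧ u₂ t.2 (e₂ t.2 x.2) = z.2) * f x z) (s := Finset.univ)
        (fun z _ => mul_nonneg (mul_nonneg (ind_nonneg _) (ind_nonneg _)) (hf0 x z))
        (Finset.mem_univ (u₁ t.1 (e₁ t.1 x.1), u₂ t.2 (e₂ t.2 x.2)))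
      have h5 : ind (fd₁ t.1 x.1 ∧ u₁ t.1 (e₁ t.1 x.1) = u₁ t.1 (e₁ t.1 x.1)) *
          ind (fd₂ t.2 x.2 ∧ u₂ t.2 (e₂ t.2 x.2) = u₂ t.2 (e₂ t.2 x.2)) = 1 := by
        rw [ind_of ⟨h1, rfl⟩, ind_of ⟨h2, rfl⟩, one_mul]
      rw [h5, one_mul] at this
      exact this
    by_cases h4 : good (u₁ t.1 (e₁ t.1 x.1)) (u₂ t.2 (e₂ t.2 x.2))
    · rw [hdec _ _ h4 h3]
      have : d x (u₁ t.1 (e₁ t.1 x.1), u₂ t.2 (e₂ t.2 x.2)) ≤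
          f x (u₁ t.1 (e₁ t.1 x.1), u₂ t.2 (e₂ t.2 x.2)) := by
        simp only [hf]
        have := mul_nonneg hD₀ (ind_nonneg (¬ good (u₁ t.1 (e₁ t.1 x.1)) (u₂ t.2 (e₂ t.2 x.2))))
        linarith
      linarith
    · have h5 := hd x (u₁ t.1 (dec (b₁ (e₁ t.1 x.1), b₂ (e₂ t.2 x.2))).1,
        u₂ t.2 (dec (b₁ (e₁ t.1 x.1), b₂ (e₂ t.2 x.2))).2)
      have h6 : D₀ ≤ f x (u₁ t.1 (e₁ t.1 x.1), u₂ t.2 (e₂ t.2 x.2)) := by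
        simp only [hf]
        rw [ind_of h4]
        have := hd0 x (u₁ t.1 (e₁ t.1 x.1), u₂ t.2 (e₂ t.2 x.2))
        linarith
      linarith
  refine (Finset.sum_le_sum fun x _ => mul_le_mul_of_nonneg_left (hpt x) (hP0 x)).trans ?_
  simp_rw [mul_add, Finset.sum_add_distrib]
  have e1 : ∀ h : X₁ × X₂ → ℝ, ∑ x, P x * (D₀ * h x) = D₀ * ∑ x, P x * h x := by
    intro h
    rw [Finset.mul_sum]
    exact Finset.sum_congr rfl fun x _ => by ring
  rw [e1 (fun x => ind (bad x)), e1 (coll t)]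
  have := mul_le_mul_of_nonneg_left hb hD₀
  linarith

/-- One-shot achievability for separate encoding of two correlated sources: rejection sampling
from random codebooks, random binning, and decoding to the unique admissible pair of words. -/
theorem exists_oneShot_code {X₁ X₂ Z₁ Z₂ : Type*} [Fintype X₁] [Fintype X₂] [Fintype Z₁]
    [Fintype Z₂] {P : X₁ × X₂ → ℝ} (hP0 : ∀ x, 0 ≤ P x) (hP1 : ∑ x, P x = 1)
    {p₁ : Z₁ → ℝ} (hp₁0 : ∀ z, 0 ≤ p₁ z) (hp₁ : ∑ z, p₁ z = 1)
    {p₂ : Z₂ → ℝ} (hp₂0 : ∀ z, 0 ≤ p₂ z) (hp₂ : ∑ z, p₂ z = 1)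
    {W₁ : X₁ → Z₁ → ℝ} (hW₁0 : ∀ x z, 0 ≤ W₁ x z) (hW₁ : ∀ x, ∑ z, W₁ x z ≤ 1)
    {W₂ : X₂ → Z₂ → ℝ} (hW₂0 : ∀ x z, 0 ≤ W₂ x z) (hW₂ : ∀ x, ∑ z, W₂ x z ≤ 1)
    {K₁ K₂ : ℝ} (hK₁ : 0 < K₁) (hK₂ : 0 < K₂) {M₁ M₂ B₁ B₂ : ℕ} (hM₁ : 0 < M₁) (hM₂ : 0 < M₂)
    (hB₁ : 0 < B₁) (hB₂ : 0 < B₂) (good : Z₁ → Z₂ → Prop) {g : ℝ}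
    (hg₁ : ∀ z₁, ∑ z₂, p₂ z₂ * ind (good z₁ z₂) ≤ g)
    (hg₂ : ∀ z₂, ∑ z₁, p₁ z₁ * ind (good z₁ z₂) ≤ g)
    {d : X₁ × X₂ → Z₁ × Z₂ → ℝ} {D₀ : ℝ} (hd0 : ∀ x z, 0 ≤ d x z) (hd : ∀ x z, d x z ≤ D₀)
    (hD₀ : 0 ≤ D₀) :
    ∃ (φ₁ : X₁ → Fin B₁) (φ₂ : X₂ → Fin B₂) (dec : Fin B₁ × Fin B₂ → Z₁ × Z₂),
      ∑ x, P x * d x (dec (φ₁ x.1, φ₂ x.2)) ≤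
        ∑ x, P x * (∑ z : Z₁ × Z₂, W₁ x.1 z.1 * W₂ x.2 z.2 *
          (d x z + D₀ * ind (¬ good z.1 z.2))) +
        D₀ * (3 * ∑ x, P x * (1 - ∑ z, min (K₁ * p₁ z) (W₁ x.1 z)) +
          3 * ∑ x, P x * (1 - ∑ z, min (K₂ * p₂ z) (W₂ x.2 z)) +
          Real.exp (-(M₁ / K₁)) + Real.exp (-(M₂ / K₂)) +
          M₁ * M₂ * g / (B₁ * B₂) + M₂ * g / B₂ + M₁ * g / B₁) := by
  obtain ⟨w₁, e₁, fd₁, hw₁0, hw₁, hm₁, hV₁, hn₁⟩ :=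
    exists_rejection_codebook hp₁0 hp₁ hW₁0 hW₁ hK₁ hM₁
  obtain ⟨w₂, e₂, fd₂, hw₂0, hw₂, hm₂, hV₂, hn₂⟩ :=
    exists_rejection_codebook hp₂0 hp₂ hW₂0 hW₂ hK₂ hM₂
  exact exists_code_of_random_codebooks hP0 hP1 hp₂0 hW₁0 hW₁ hW₂0 hW₂ hK₂ hM₁ hM₂
    hB₁ hB₂ good hg₁ hg₂ (u₁ := fun t i => (t i).1) (u₂ := fun t i => (t i).1)
    hw₁0 hw₁ hm₁ hV₁ hn₁ hw₂0 hw₂ hm₂ hV₂ hn₂ hd0 hd hD₀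

end OneShot

/-! ### Finite laws and tail bounds for the information density. -/

section FiniteLaws

variable {Ω Ω' α β : Type*} [Fintype Ω] [Fintype Ω'] [Fintype α] [Fintype β]

theorem sum_toReal (p : PMF Ω) : ∑ ω, (p ω).toReal = 1 := by
  rw [← ENNReal.toReal_sum (fun ω _ => p.apply_ne_top ω), ← tsum_fintype (L := .unconditional Ω),
    p.tsum_coe, ENNReal.toReal_one]

omit [Fintype Ω'] in
theorem map_toReal (p : PMF Ω) (f : Ω → Ω') (b : Ω') :
    ((p.map f) b).toReal = ∑ ω, (p ω).toReal * ind (f ω = b) := by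
  classical
  rw [PMF.map_apply, tsum_fintype, ENNReal.toReal_sum]
  · refine Finset.sum_congr rfl fun ω _ => ?_
    by_cases h : f ω = b
    · rw [if_pos h.symm, ind_of h, mul_one]
    · rw [if_neg (Ne.symm h), ind_of_not h]; simp
  · intro ω _
    split_ifs
    exacts [p.apply_ne_top ω, ENNReal.zero_ne_top]

theorem expect_map (p : PMF Ω) (f : Ω → Ω') (g : Ω' → ℝ) :
    expect (p.map f) g = expect p (fun ω => g (f ω)) := by
  classical
  unfold expect
  simp_rw [map_toReal, Finset.sum_mul]
  rw [Finset.sum_comm]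
  refine Finset.sum_congr rfl fun ω _ => ?_
  rw [Finset.sum_eq_single (f ω)]
  · simp
  · intro b _ hb
    rw [ind_of_not hb.symm]; simp
  · simp

/-- Comparison is asked only on the support, because the information density is meaningless at null
pairs. -/
theorem expect_mono {p : PMF Ω} {f g : Ω → ℝ} (h : ∀ ω, 0 < (p ω).toReal → f ω ≤ g ω) :
    expect p f ≤ expect p g := by
  refine Finset.sum_le_sum fun ω _ => ?_
  rcases (ENNReal.toReal_nonneg (a := p ω)).eq_or_lt with h0 | h0
  · rw [← h0]; simp
  · exact mul_le_mul_of_nonneg_left (h ω h0) h0.le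

theorem expect_nonneg {p : PMF Ω} {f : Ω → ℝ} (h : ∀ ω, 0 ≤ f ω) : 0 ≤ expect p f :=
  Finset.sum_nonneg fun ω _ => mul_nonneg ENNReal.toReal_nonneg (h ω)

theorem expect_one (p : PMF Ω) : expect p (fun _ => 1) = 1 := by
  simp [expect, sum_toReal]

theorem expect_add (p : PMF Ω) (f g : Ω → ℝ) :
    expect p (fun ω => f ω + g ω) = expect p f + expect p g := by
  simp [expect, mul_add, Finset.sum_add_distrib]

theorem toOuterMeasure_toReal (p : PMF Ω) (E : Ω → Prop) :
    (p.toOuterMeasure {ω | E ω}).toReal = expect p (fun ω => ind (E ω)) := by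
  classical
  rw [PMF.toOuterMeasure_apply_fintype, ENNReal.toReal_sum]
  · refine Finset.sum_congr rfl fun ω _ => ?_
    beta_reduce
    by_cases h : E ω
    · rw [Set.indicator_of_mem (by exact h), ind_of h, mul_one]
    · rw [Set.indicator_of_notMem (by exact h), ind_of_not h]; simp
  · intro ω _
    refine ne_of_lt (lt_of_le_of_lt (Set.indicator_le_self _ _ _) (p.apply_lt_top ω))

theorem tendsto_toOuterMeasure_iff {Ω : ℕ → Type*} [∀ n, Fintype (Ω n)]
    (p : (n : ℕ) → PMF (Ω n)) (E : (n : ℕ) → Ω n → Prop) :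
    Tendsto (fun n => (p n).toOuterMeasure {ω | E n ω}) atTop (𝓝 0) ↔
      Tendsto (fun n => expect (p n) (fun ω => ind (E n ω))) atTop (𝓝 0) := by
  simp_rw [← toOuterMeasure_toReal]
  refine (ENNReal.tendsto_toReal_zero_iff fun n => ?_).symm
  have : (p n).toOuterMeasure {ω | E n ω} ≤ 1 := by
    rw [PMF.toOuterMeasure_apply, ← (p n).tsum_coe]
    exact ENNReal.tsum_le_tsum fun ω => Set.indicator_le_self _ _ _
  exact ne_top_of_le_ne_top ENNReal.one_ne_top this

theorem pLimsup_le_of_tendsto {Ω : ℕ → Type*} [∀ n, Fintype (Ω n)]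
    {p : (n : ℕ) → PMF (Ω n)} {Z : (n : ℕ) → Ω n → ℝ} {a : ℝ}
    (h : Tendsto (fun n => expect (p n) (fun ω => ind (a < Z n ω))) atTop (𝓝 0)) :
    pLimsup p Z ≤ a :=
  sInf_le ⟨a, (tendsto_toOuterMeasure_iff p _).2 h, rfl⟩

/-- The levels whose tail probability vanishes form an upward closed set, so every level strictly
above the infimum belongs to it. -/
theorem tendsto_of_pLimsup_lt {Ω : ℕ → Type*} [∀ n, Fintype (Ω n)]
    {p : (n : ℕ) → PMF (Ω n)} {Z : (n : ℕ) → Ω n → ℝ} {a : ℝ} (h : pLimsup p Z < a) :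
    Tendsto (fun n => expect (p n) (fun ω => ind (a < Z n ω))) atTop (𝓝 0) := by
  obtain ⟨_, ⟨b, hb, rfl⟩, hba⟩ := sInf_lt_iff.1 h
  have hb' := (tendsto_toOuterMeasure_iff p _).1 hb
  refine squeeze_zero (fun n => expect_nonneg fun ω => ind_nonneg _) (fun n => ?_) hb'
  exact expect_mono fun ω _ => ind_mono fun h => (EReal.coe_lt_coe_iff.1 hba).trans h

theorem le_map_fst (p : PMF (α × β)) (v : α) (w : β) :
    (p (v, w)).toReal ≤ ((p.map Prod.fst) v).toReal := by
  rw [map_toReal]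
  refine le_trans (le_of_eq ?_) (Finset.single_le_sum (fun ω _ =>
    mul_nonneg ENNReal.toReal_nonneg (ind_nonneg _)) (Finset.mem_univ (v, w)))
  simp

theorem le_map_snd (p : PMF (α × β)) (v : α) (w : β) :
    (p (v, w)).toReal ≤ ((p.map Prod.snd) w).toReal := by
  rw [map_toReal]
  refine le_trans (le_of_eq ?_) (Finset.single_le_sum (fun ω _ =>
    mul_nonneg ENNReal.toReal_nonneg (ind_nonneg _)) (Finset.mem_univ (v, w)))
  simp

theorem sum_fst (p : PMF (α × β)) (v : α) :
    ∑ w, (p (v, w)).toReal = ((p.map Prod.fst) v).toReal := by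
  classical
  rw [map_toReal, Fintype.sum_prod_type, Finset.sum_eq_single v]
  · simp
  · intro b _ hb
    simp [ind_of_not hb]
  · simp

theorem sum_snd (p : PMF (α × β)) (w : β) :
    ∑ v, (p (v, w)).toReal = ((p.map Prod.snd) w).toReal := by
  classical
  rw [map_toReal, Fintype.sum_prod_type_right, Finset.sum_eq_single w]
  · simp
  · intro b _ hb
    simp [ind_of_not hb]
  · simp

/-- Positive joint mass forces positive marginals, so the logarithm is genuine. At a null pair the
density would be the default value `Real.log 0 = 0`. -/
theorem lt_infoDensity_iff {n : ℕ} (hn : 1 ≤ n) {p : PMF (α × β)} {vw : α × β}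
    (h : 0 < (p vw).toReal) (a : ℝ) : a < infoDensity n p vw ↔
      Real.exp (n * a) * (((p.map Prod.fst) vw.1).toReal * ((p.map Prod.snd) vw.2).toReal)
        < (p vw).toReal := by
  have h1 : 0 < ((p.map Prod.fst) vw.1).toReal := h.trans_le (le_map_fst p vw.1 vw.2)
  have h2 : 0 < ((p.map Prod.snd) vw.2).toReal := h.trans_le (le_map_snd p vw.1 vw.2)
  have hn' : (0 : ℝ) < n := by exact_mod_cast hn
  unfold infoDensity
  rw [← lt_div_iff₀ (mul_pos h1 h2), ← Real.lt_log_iff_exp_lt (by positivity),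
    one_div_mul_eq_div, lt_div_iff₀ hn', mul_comm a]

theorem infoDensity_lt_iff {n : ℕ} (hn : 1 ≤ n) {p : PMF (α × β)} {vw : α × β}
    (h : 0 < (p vw).toReal) (a : ℝ) : infoDensity n p vw < a ↔
      (p vw).toReal <
      Real.exp (n * a) * (((p.map Prod.fst) vw.1).toReal * ((p.map Prod.snd) vw.2).toReal) := by
  have h1 : 0 < ((p.map Prod.fst) vw.1).toReal := h.trans_le (le_map_fst p vw.1 vw.2)
  have h2 : 0 < ((p.map Prod.snd) vw.2).toReal := h.trans_le (le_map_snd p vw.1 vw.2)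
  have hn' : (0 : ℝ) < n := by exact_mod_cast hn
  unfold infoDensity
  rw [← div_lt_iff₀ (mul_pos h1 h2), ← Real.log_lt_iff_lt_exp (by positivity),
    one_div_mul_eq_div, div_lt_iff₀ hn', mul_comm a]

/-- The information density is unlikely to be much below zero. -/
theorem expect_infoDensity_lt_le {n : ℕ} (hn : 1 ≤ n) (p : PMF (α × β)) (a : ℝ) :
    expect p (fun vw => ind (infoDensity n p vw < a)) ≤ Real.exp (n * a) := by
  -- Change of measure: on the event the joint mass is below `exp (n * a)` times the product of the
  -- marginals, which has total mass one.
  have h1 : ∀ vw : α × β, (p vw).toReal * ind (infoDensity n p vw < a) ≤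
      Real.exp (n * a) * (((p.map Prod.fst) vw.1).toReal * ((p.map Prod.snd) vw.2).toReal) := by
    intro vw
    have h0 : 0 ≤ Real.exp (n * a) *
      (((p.map Prod.fst) vw.1).toReal * ((p.map Prod.snd) vw.2).toReal) := by positivity
    by_cases h : infoDensity n p vw < a
    · rw [ind_of h, mul_one]
      rcases (ENNReal.toReal_nonneg (a := p vw)).eq_or_lt with h2 | h2
      · rwa [← h2]
      · exact ((infoDensity_lt_iff hn h2 a).1 h).le
    · rw [ind_of_not h, mul_zero]; exact h0
  refine (Finset.sum_le_sum fun vw _ => h1 vw).trans (le_of_eq ?_)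
  rw [← Finset.mul_sum, Fintype.sum_prod_type]
  simp only
  rw [← Finset.sum_mul_sum, sum_toReal, sum_toReal]
  ring

/-- Each atom counted weighs at most `K⁻¹`, and only those in `S` carry mass. -/
theorem expect_small_atoms_le (p : PMF Ω) (S : Finset Ω) (hS : ∀ ω ∉ S, (p ω).toReal = 0)
    {K : ℝ} (hK : 0 < K) : expect p (fun ω => ind (K * (p ω).toReal < 1)) ≤ S.card * K⁻¹ := by
  unfold expect
  rw [← Finset.sum_subset (Finset.subset_univ S) (fun ω _ h => by rw [hS ω h, zero_mul])]
  refine (Finset.sum_le_card_nsmul S _ K⁻¹ fun ω _ => ?_).trans (le_of_eq (nsmul_eq_mul _ _))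
  beta_reduce
  by_cases h : K * (p ω).toReal < 1
  · rw [ind_of h, mul_one, ← one_div, le_div_iff₀ hK]; linarith
  · rw [ind_of_not h, mul_zero]; positivity

/-- The information density is unlikely to exceed the normalized log-size of the second
alphabet. -/
theorem expect_lt_infoDensity_le_card_snd {n : ℕ} (hn : 1 ≤ n) (p : PMF (α × β)) (a : ℝ)
    (S : Finset β) (hS : ∀ w ∉ S, ((p.map Prod.snd) w).toReal = 0) :
    expect p (fun vw => ind (a < infoDensity n p vw)) ≤ S.card * Real.exp (-(n * a)) := by
  rw [Real.exp_neg]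
  refine le_trans ?_ (expect_small_atoms_le (p.map Prod.snd) S hS (Real.exp_pos _))
  rw [expect_map]
  -- Since the joint mass is at most the first marginal, a density above `a` forces the second
  -- marginal below `exp (-n a)`.
  refine expect_mono fun vw h => ind_mono fun h1 => ?_
  rw [lt_infoDensity_iff hn h] at h1
  have h2 := le_map_fst p vw.1 vw.2
  have h3 : 0 < ((p.map Prod.fst) vw.1).toReal := h.trans_le h2
  refine lt_of_mul_lt_mul_right ?_ h3.le
  rw [one_mul]
  calc _ = _ := by ring
    _ < _ := h1
    _ ≤ _ := h2

/-- The information density is unlikely to exceed the normalized log-size of the first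
alphabet. -/
theorem expect_lt_infoDensity_le_card_fst {n : ℕ} (hn : 1 ≤ n) (p : PMF (α × β)) (a : ℝ) :
    expect p (fun vw => ind (a < infoDensity n p vw)) ≤
      Fintype.card α * Real.exp (-(n * a)) := by
  rw [Real.exp_neg]
  refine le_trans ?_ (expect_small_atoms_le (p.map Prod.fst) Finset.univ (by simp)
    (Real.exp_pos _))
  rw [expect_map]
  refine expect_mono fun vw h => ind_mono fun h1 => ?_
  rw [lt_infoDensity_iff hn h] at h1
  have h2 := le_map_snd p vw.1 vw.2
  have h3 : 0 < ((p.map Prod.snd) vw.2).toReal := h.trans_le h2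
  refine lt_of_mul_lt_mul_right ?_ h3.le
  rw [one_mul]
  calc _ = _ := by ring
    _ < _ := h1
    _ ≤ _ := h2

omit [Fintype α] [Fintype β] in
theorem condProb_nonneg (r : PMF (α × β)) (a : α) (b : β) : 0 ≤ condProb r b a :=
  div_nonneg ENNReal.toReal_nonneg ENNReal.toReal_nonneg

/-- Only an inequality: the sum is `0` when `a` has no mass. -/
theorem sum_condProb_le_one (r : PMF (α × β)) (a : α) : ∑ b, condProb r b a ≤ 1 := by
  unfold condProb
  rw [← Finset.sum_div, sum_fst]
  exact div_self_le_one _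

theorem map_fst_mul_condProb (r : PMF (α × β)) (a : α) (b : β) :
    ((r.map Prod.fst) a).toReal * condProb r b a = (r (a, b)).toReal := by
  unfold condProb
  rcases (ENNReal.toReal_nonneg (a := (r.map Prod.fst) a)).eq_or_lt with h | h
  · have h1 := le_map_fst r a b
    rw [← h] at h1 ⊢
    rw [zero_mul]
    exact le_antisymm ENNReal.toReal_nonneg h1
  · rw [mul_div_cancel₀ _ h.ne']

/-- The mass lost by truncating a channel at a multiple of its output law. -/
theorem expect_truncation_le (r : PMF (α × β)) {K : ℝ} (hK : 0 ≤ K) :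
    expect (r.map Prod.fst) (fun a => 1 - ∑ b, min (K * ((r.map Prod.snd) b).toReal)
      (condProb r b a)) ≤
    expect r (fun t => ind (K * (((r.map Prod.fst) t.1).toReal * ((r.map Prod.snd) t.2).toReal)
      < (r t).toReal)) := by
  unfold expect
  rw [Fintype.sum_prod_type (f := fun t => (r t).toReal * _)]
  refine Finset.sum_le_sum fun a _ => ?_
  rw [mul_sub, mul_one, ← sum_fst, Finset.mul_sum, ← Finset.sum_sub_distrib]
  refine Finset.sum_le_sum fun b _ => ?_
  rw [sum_fst, mul_min_of_nonneg _ _ ENNReal.toReal_nonneg, map_fst_mul_condProb]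
  -- After weighting by the first marginal, a pair loses mass only if it exceeds `K` times the
  -- product of the marginals, and then at most its whole mass.
  by_cases h : K * (((r.map Prod.fst) a).toReal * ((r.map Prod.snd) b).toReal)
      < (r (a, b)).toReal
  · rw [ind_of h, mul_one, sub_le_self_iff]
    exact le_min (by positivity) ENNReal.toReal_nonneg
  · rw [ind_of_not h, mul_zero, sub_nonpos, le_min_iff]
    refine ⟨?_, le_rfl⟩
    push Not at h
    calc _ ≤ _ := h
      _ = _ := by ring

/-- Packing bound: an independent `b` looks jointly typical with `a` with probability at most `G⁻¹`,
because each such `b` has mass at most `r (a, b) / (G * P(a))` and the `r (a, b)` sum to `P(a)`.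
Requiring `0 < r (a, b)` excludes null `a`, for which the second condition alone would always hold.
-/
theorem sum_snd_mul_ind_le (r : PMF (α × β)) {G : ℝ} (hG : 0 < G) (a : α) :
    ∑ b, ((r.map Prod.snd) b).toReal * ind (0 < (r (a, b)).toReal ∧
      G * (((r.map Prod.fst) a).toReal * ((r.map Prod.snd) b).toReal) ≤ (r (a, b)).toReal) ≤
      G⁻¹ := by
  rcases (ENNReal.toReal_nonneg (a := (r.map Prod.fst) a)).eq_or_lt with h | h
  · have : ∀ b, ¬ 0 < (r (a, b)).toReal := fun b => by
      have := le_map_fst r a b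
      rw [← h] at this
      exact not_lt.2 this
    simp only [this, false_and]
    rw [Finset.sum_eq_zero fun b _ => by rw [ind_of_not not_false, mul_zero]]
    positivity
  · have h1 : ∀ b, ((r.map Prod.snd) b).toReal * ind (0 < (r (a, b)).toReal ∧
        G * (((r.map Prod.fst) a).toReal * ((r.map Prod.snd) b).toReal) ≤ (r (a, b)).toReal) ≤
        (r (a, b)).toReal * (G * ((r.map Prod.fst) a).toReal)⁻¹ := by
      intro b
      by_cases h2 : 0 < (r (a, b)).toReal ∧
        G * (((r.map Prod.fst) a).toReal * ((r.map Prod.snd) b).toReal) ≤ (r (a, b)).toReal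
      · rw [ind_of h2, mul_one, ← div_eq_mul_inv, le_div_iff₀ (by positivity)]
        calc _ = _ := by ring
          _ ≤ _ := h2.2
      · rw [ind_of_not h2, mul_zero]; positivity
    refine (Finset.sum_le_sum fun b _ => h1 b).trans (le_of_eq ?_)
    rw [← Finset.sum_mul, sum_fst]
    field_simp

theorem sum_fst_mul_ind_le (r : PMF (α × β)) {G : ℝ} (hG : 0 < G) (b : β) :
    ∑ a, ((r.map Prod.fst) a).toReal * ind (0 < (r (a, b)).toReal ∧
      G * (((r.map Prod.fst) a).toReal * ((r.map Prod.snd) b).toReal) ≤ (r (a, b)).toReal) ≤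
      G⁻¹ := by
  rcases (ENNReal.toReal_nonneg (a := (r.map Prod.snd) b)).eq_or_lt with h | h
  · have : ∀ a, ¬ 0 < (r (a, b)).toReal := fun a => by
      have := le_map_snd r a b
      rw [← h] at this
      exact not_lt.2 this
    simp only [this, false_and]
    rw [Finset.sum_eq_zero fun b _ => by rw [ind_of_not not_false, mul_zero]]
    positivity
  · have h1 : ∀ a, ((r.map Prod.fst) a).toReal * ind (0 < (r (a, b)).toReal ∧
        G * (((r.map Prod.fst) a).toReal * ((r.map Prod.snd) b).toReal) ≤ (r (a, b)).toReal) ≤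
        (r (a, b)).toReal * (G * ((r.map Prod.snd) b).toReal)⁻¹ := by
      intro a
      by_cases h2 : 0 < (r (a, b)).toReal ∧
        G * (((r.map Prod.fst) a).toReal * ((r.map Prod.snd) b).toReal) ≤ (r (a, b)).toReal
      · rw [ind_of h2, mul_one, ← div_eq_mul_inv, le_div_iff₀ (by positivity)]
        calc _ = _ := by ring
          _ ≤ _ := h2.2
      · rw [ind_of_not h2, mul_zero]; positivity
    refine (Finset.sum_le_sum fun a _ => h1 a).trans (le_of_eq ?_)
    rw [← Finset.sum_mul, sum_snd]
    field_simp

end FiniteLaws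

/-! ### Separately generated descriptions: coding bound and data processing. -/

section SeparateGeneration

variable {X₁ X₂ Z₁ Z₂ : Type*} [Fintype X₁] [Fintype X₂] [Fintype Z₁] [Fintype Z₂]
  {p : PMF (X₁ × X₂)} {q : PMF ((X₁ × X₂) × (Z₁ × Z₂))}

omit [Fintype X₁] [Fintype X₂] [Fintype Z₁] [Fintype Z₂] in
theorem margX1Z1_map_fst (h : SeparatelyGenerated p q) :
    (margX1Z1 q).map Prod.fst = p.map Prod.fst := by
  rw [← h.1, margX1Z1, PMF.map_comp, PMF.map_comp]; rfl

omit [Fintype X₁] [Fintype X₂] [Fintype Z₁] [Fintype Z₂] in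
theorem margX2Z2_map_fst (h : SeparatelyGenerated p q) :
    (margX2Z2 q).map Prod.fst = p.map Prod.snd := by
  rw [← h.1, margX2Z2, PMF.map_comp, PMF.map_comp]; rfl

omit [Fintype X₁] [Fintype X₂] [Fintype Z₁] [Fintype Z₂] in
theorem margX1Z1_map_snd : (margX1Z1 q).map Prod.snd = (margZ1Z2 q).map Prod.fst := by
  rw [margX1Z1, margZ1Z2, PMF.map_comp, PMF.map_comp]; rfl

omit [Fintype X₁] [Fintype X₂] [Fintype Z₁] [Fintype Z₂] in
theorem margX2Z2_map_snd : (margX2Z2 q).map Prod.snd = (margZ1Z2 q).map Prod.snd := by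
  rw [margX2Z2, margZ1Z2, PMF.map_comp, PMF.map_comp]; rfl

theorem expect_separatelyGenerated (h : SeparatelyGenerated p q)
    (F : (X₁ × X₂) × (Z₁ × Z₂) → ℝ) :
    expect q F = ∑ x : X₁ × X₂, (p x).toReal * ∑ z : Z₁ × Z₂,
      condProb (margX1Z1 q) z.1 x.1 * condProb (margX2Z2 q) z.2 x.2 * F (x, z) := by
  unfold expect
  rw [Fintype.sum_prod_type]
  refine Finset.sum_congr rfl fun x _ => ?_
  rw [Finset.mul_sum]
  refine Finset.sum_congr rfl fun z _ => ?_
  rw [h.2 x.1 x.2 z.1 z.2]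
  ring

/-- One-shot achievability in terms of information densities. -/
theorem exists_code_expect_le (h : SeparatelyGenerated p q) {n : ℕ} (hn : 1 ≤ n) (a₁ a₂ b : ℝ)
    {M₁ M₂ B₁ B₂ : ℕ} (hM₁ : 0 < M₁) (hM₂ : 0 < M₂) (hB₁ : 0 < B₁) (hB₂ : 0 < B₂)
    {d : X₁ × X₂ → Z₁ × Z₂ → ℝ} {D₀ : ℝ} (hd0 : ∀ x z, 0 ≤ d x z) (hd : ∀ x z, d x z ≤ D₀)
    (hD₀ : 0 ≤ D₀) :
    ∃ (φ₁ : X₁ → Fin B₁) (φ₂ : X₂ → Fin B₂) (dec : Fin B₁ × Fin B₂ → Z₁ × Z₂),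
      expect p (fun x => d x (dec (φ₁ x.1, φ₂ x.2))) ≤
        expect q (fun t => d t.1 t.2) +
        D₀ * (expect (margZ1Z2 q) (fun z => ind (infoDensity n (margZ1Z2 q) z < b)) +
          3 * expect (margX1Z1 q) (fun t => ind (a₁ < infoDensity n (margX1Z1 q) t)) +
          3 * expect (margX2Z2 q) (fun t => ind (a₂ < infoDensity n (margX2Z2 q) t)) +
          Real.exp (-(M₁ / Real.exp (n * a₁))) + Real.exp (-(M₂ / Real.exp (n * a₂))) +
          M₁ * M₂ * (Real.exp (n * b))⁻¹ / (B₁ * B₂) + M₂ * (Real.exp (n * b))⁻¹ / B₂ +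
          M₁ * (Real.exp (n * b))⁻¹ / B₁) := by
  set r := margZ1Z2 q with hr
  -- Admissible pairs have density at least `b`, so `g = exp (-n b)`; the channels are truncated at
  -- `K = exp (n * a₁)` and `exp (n * a₂)`.
  set good : Z₁ → Z₂ → Prop := fun z₁ z₂ => 0 < (r (z₁, z₂)).toReal ∧
    Real.exp (n * b) * (((r.map Prod.fst) z₁).toReal * ((r.map Prod.snd) z₂).toReal) ≤
      (r (z₁, z₂)).toReal with hgood
  obtain ⟨φ₁, φ₂, dec, hc⟩ := exists_oneShot_code (P := fun x => (p x).toReal)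
    (fun x => ENNReal.toReal_nonneg) (sum_toReal p)
    (p₁ := fun z => ((r.map Prod.fst) z).toReal) (fun z => ENNReal.toReal_nonneg) (sum_toReal _)
    (p₂ := fun z => ((r.map Prod.snd) z).toReal) (fun z => ENNReal.toReal_nonneg) (sum_toReal _)
    (W₁ := fun x z => condProb (margX1Z1 q) z x) (fun x z => condProb_nonneg _ _ _)
    (fun x => sum_condProb_le_one _ _)
    (W₂ := fun x z => condProb (margX2Z2 q) z x) (fun x z => condProb_nonneg _ _ _)
    (fun x => sum_condProb_le_one _ _)
    (Real.exp_pos (n * a₁)) (Real.exp_pos (n * a₂)) hM₁ hM₂ hB₁ hB₂ good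
    (g := (Real.exp (n * b))⁻¹) (sum_snd_mul_ind_le r (Real.exp_pos _))
    (sum_fst_mul_ind_le r (Real.exp_pos _)) hd0 hd hD₀
  refine ⟨φ₁, φ₂, dec, hc.trans ?_⟩
  have h1 : ∑ x : X₁ × X₂, (p x).toReal * (1 - ∑ z, min (Real.exp (n * a₁) *
      ((r.map Prod.fst) z).toReal) (condProb (margX1Z1 q) z x.1)) ≤
      expect (margX1Z1 q) (fun t => ind (a₁ < infoDensity n (margX1Z1 q) t)) := by
    have e1 := expect_truncation_le (margX1Z1 q) (Real.exp_pos (n * a₁)).le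
    rw [margX1Z1_map_fst h, expect_map, margX1Z1_map_snd] at e1
    refine e1.trans (expect_mono fun t ht => ind_mono fun h2 => ?_)
    rwa [lt_infoDensity_iff hn ht, margX1Z1_map_fst h, margX1Z1_map_snd]
  have h2 : ∑ x : X₁ × X₂, (p x).toReal * (1 - ∑ z, min (Real.exp (n * a₂) *
      ((r.map Prod.snd) z).toReal) (condProb (margX2Z2 q) z x.2)) ≤
      expect (margX2Z2 q) (fun t => ind (a₂ < infoDensity n (margX2Z2 q) t)) := by
    have e1 := expect_truncation_le (margX2Z2 q) (Real.exp_pos (n * a₂)).le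
    rw [margX2Z2_map_fst h, expect_map, margX2Z2_map_snd] at e1
    refine e1.trans (expect_mono fun t ht => ind_mono fun h2 => ?_)
    rwa [lt_infoDensity_iff hn ht, margX2Z2_map_fst h, margX2Z2_map_snd]
  have h3 : expect q (fun t => ind (¬ good t.2.1 t.2.2)) ≤
      expect r (fun z => ind (infoDensity n r z < b)) := by
    have e1 : expect q (fun t => ind (¬ good t.2.1 t.2.2)) =
        expect r (fun z => ind (¬ good z.1 z.2)) := by
      rw [hr, margZ1Z2, expect_map]
    rw [e1]
    refine expect_mono fun z hz => ind_mono fun h4 => ?_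
    rw [infoDensity_lt_iff hn hz]
    by_contra h5
    exact h4 ⟨hz, not_lt.1 h5⟩
  have h4 : ∑ x : X₁ × X₂, (p x).toReal * ∑ z : Z₁ × Z₂,
      condProb (margX1Z1 q) z.1 x.1 * condProb (margX2Z2 q) z.2 x.2 *
        (d x z + D₀ * ind (¬ good z.1 z.2)) =
      expect q (fun t => d t.1 t.2) + D₀ * expect q (fun t => ind (¬ good t.2.1 t.2.2)) := by
    rw [← expect_separatelyGenerated h (fun t => d t.1 t.2 + D₀ * ind (¬ good t.2.1 t.2.2)),
      expect_add]
    congr 1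
    unfold expect
    rw [Finset.mul_sum]
    exact Finset.sum_congr rfl fun _ _ => by ring
  rw [h4]
  have h5 : expect q (fun t => ind (¬ good t.2.1 t.2.2)) +
      (3 * ∑ x : X₁ × X₂, (p x).toReal * (1 - ∑ z, min (Real.exp (n * a₁) *
        ((r.map Prod.fst) z).toReal) (condProb (margX1Z1 q) z x.1)) +
      3 * ∑ x : X₁ × X₂, (p x).toReal * (1 - ∑ z, min (Real.exp (n * a₂) *
        ((r.map Prod.snd) z).toReal) (condProb (margX2Z2 q) z x.2))) ≤
      expect r (fun z => ind (infoDensity n r z < b)) +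
      (3 * expect (margX1Z1 q) (fun t => ind (a₁ < infoDensity n (margX1Z1 q) t)) +
      3 * expect (margX2Z2 q) (fun t => ind (a₂ < infoDensity n (margX2Z2 q) t))) := by
    linarith
  have h6 := mul_le_mul_of_nonneg_left h5 hD₀
  linarith

/-- Data processing: the information density of the two descriptions rarely exceeds that of a
source and its description. -/
theorem one_le_expect_infoDensity_add (h : SeparatelyGenerated p q) {n : ℕ} (hn : 1 ≤ n)
    (a b : ℝ) :
    1 ≤ expect (margX1Z1 q) (fun t => ind (a < infoDensity n (margX1Z1 q) t)) +
      expect (margZ1Z2 q) (fun z => ind (infoDensity n (margZ1Z2 q) z < b)) +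
      Real.exp (n * a) * (Real.exp (n * b))⁻¹ := by
  set r := margZ1Z2 q with hr
  set good : Z₁ → Z₂ → Prop := fun z₁ z₂ => 0 < (r (z₁, z₂)).toReal ∧
    Real.exp (n * b) * (((r.map Prod.fst) z₁).toReal * ((r.map Prod.snd) z₂).toReal) ≤
      (r (z₁, z₂)).toReal with hgood
  set low : X₁ → Z₁ → Prop := fun x z =>
    condProb (margX1Z1 q) z x ≤ Real.exp (n * a) * ((r.map Prod.fst) z).toReal with hlow
  -- Three events cover the support: source density above `a`, description density below `b`, or
  -- neither. Only the last needs an estimate.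
  have hpt : ∀ t : (X₁ × X₂) × (Z₁ × Z₂), 0 < (q t).toReal → 1 ≤
      ind (a < infoDensity n (margX1Z1 q) (t.1.1, t.2.1)) + ind (infoDensity n r t.2 < b) +
      ind (low t.1.1 t.2.1 ∧ good t.2.1 t.2.2) := by
    intro t ht
    have m1 : 0 < (margX1Z1 q (t.1.1, t.2.1)).toReal := by
      rw [margX1Z1, map_toReal]
      refine lt_of_lt_of_le ?_ (Finset.single_le_sum (fun ω _ =>
        mul_nonneg ENNReal.toReal_nonneg (ind_nonneg _)) (Finset.mem_univ t))
      rw [ind_of rfl, mul_one]; exact ht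
    have m2 : 0 < (r t.2).toReal := by
      rw [hr, margZ1Z2, map_toReal]
      refine lt_of_lt_of_le ?_ (Finset.single_le_sum (fun ω _ =>
        mul_nonneg ENNReal.toReal_nonneg (ind_nonneg _)) (Finset.mem_univ t))
      rw [ind_of rfl, mul_one]; exact ht
    have n1 := ind_nonneg (a < infoDensity n (margX1Z1 q) (t.1.1, t.2.1))
    have n2 := ind_nonneg (infoDensity n r t.2 < b)
    have n3 := ind_nonneg (low t.1.1 t.2.1 ∧ good t.2.1 t.2.2)
    by_cases c1 : a < infoDensity n (margX1Z1 q) (t.1.1, t.2.1)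
    · rw [ind_of c1]; linarith
    by_cases c2 : infoDensity n r t.2 < b
    · rw [ind_of c2]; linarith
    rw [ind_of (p := low t.1.1 t.2.1 ∧ good t.2.1 t.2.2)]
    · linarith
    rw [lt_infoDensity_iff hn m1, not_lt] at c1
    rw [infoDensity_lt_iff hn m2, not_lt] at c2
    refine ⟨?_, m2, c2⟩
    have m3 := m1.trans_le (le_map_fst _ _ _)
    simp only [hlow, condProb]
    rw [div_le_iff₀ m3]
    refine c1.trans (le_of_eq ?_)
    rw [margX1Z1_map_snd]
    ring
  have h1 : 1 ≤ expect (margX1Z1 q) (fun t => ind (a < infoDensity n (margX1Z1 q) t)) +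
      expect r (fun z => ind (infoDensity n r z < b)) +
      expect q (fun t => ind (low t.1.1 t.2.1 ∧ good t.2.1 t.2.2)) := by
    have e1 : expect (margX1Z1 q) (fun t => ind (a < infoDensity n (margX1Z1 q) t)) =
        expect q (fun t => ind (a < infoDensity n (margX1Z1 q) (t.1.1, t.2.1))) := by
      conv_lhs => rw [margX1Z1, expect_map]
      rfl
    have e2 : expect r (fun z => ind (infoDensity n r z < b)) =
        expect q (fun t => ind (infoDensity n r t.2 < b)) := by
      conv_lhs => rw [hr, margZ1Z2, expect_map]
      rfl
    rw [e1, e2, ← expect_add, ← expect_add, ← expect_one q]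
    exact expect_mono hpt
  have hW₂ : ∀ z₂, ∑ x : X₁ × X₂, (p x).toReal * condProb (margX2Z2 q) z₂ x.2 =
      ((r.map Prod.snd) z₂).toReal := by
    intro z₂
    have e1 := expect_map p Prod.snd (fun x => condProb (margX2Z2 q) z₂ x)
    unfold expect at e1
    rw [← e1, ← margX2Z2_map_fst h]
    simp_rw [map_fst_mul_condProb]
    rw [sum_snd, margX2Z2_map_snd]
  -- On `low` the first channel is at most `exp (n * a)` times its output law, which does not depend
  -- on `x`. Averaging over `x` then makes the two descriptions independent, and the packing bound
  -- applies.
  have h2 : expect q (fun t => ind (low t.1.1 t.2.1 ∧ good t.2.1 t.2.2)) ≤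
      Real.exp (n * a) * (Real.exp (n * b))⁻¹ := by
    rw [expect_separatelyGenerated h]
    calc _ ≤ ∑ x : X₁ × X₂, (p x).toReal * ∑ z : Z₁ × Z₂, Real.exp (n * a) *
          ((r.map Prod.fst) z.1).toReal * condProb (margX2Z2 q) z.2 x.2 *
            ind (good z.1 z.2) := by
          refine Finset.sum_le_sum fun x _ => mul_le_mul_of_nonneg_left
            (Finset.sum_le_sum fun z _ => ?_) ENNReal.toReal_nonneg
          have c2 := condProb_nonneg (margX2Z2 q) x.2 z.2
          by_cases hl : low x.1 z.1 ∧ good z.1 z.2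
          · simp only
            rw [ind_of hl, ind_of hl.2, mul_one, mul_one]
            exact mul_le_mul_of_nonneg_right hl.1 c2
          · simp only
            rw [ind_of_not hl, mul_zero]
            exact mul_nonneg (mul_nonneg (by positivity) c2) (ind_nonneg _)
      _ = Real.exp (n * a) * ∑ z : Z₁ × Z₂, ((r.map Prod.fst) z.1).toReal *
          (((r.map Prod.snd) z.2).toReal * ind (good z.1 z.2)) := by
          simp_rw [Finset.mul_sum]
          rw [Finset.sum_comm]
          refine Finset.sum_congr rfl fun z _ => ?_
          rw [← hW₂, Finset.sum_mul, Finset.mul_sum, Finset.mul_sum]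
          exact Finset.sum_congr rfl fun x _ => by ring
      _ = Real.exp (n * a) * ∑ z₁, ((r.map Prod.fst) z₁).toReal *
          ∑ z₂, ((r.map Prod.snd) z₂).toReal * ind (good z₁ z₂) := by
          rw [Fintype.sum_prod_type]
          simp_rw [Finset.mul_sum]
      _ ≤ Real.exp (n * a) * ∑ z₁, ((r.map Prod.fst) z₁).toReal * (Real.exp (n * b))⁻¹ := by
          gcongr with z₁
          exact sum_snd_mul_ind_le r (Real.exp_pos _) z₁
      _ = _ := by rw [← Finset.sum_mul, sum_toReal, one_mul]
  linarith

end SeparateGeneration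

/-! ### Exchanging the two terminals. -/

section Swap

variable {X₁ X₂ Z₁ Z₂ : Type*} [Fintype X₁] [Fintype X₂] [Fintype Z₁] [Fintype Z₂]
  {p : PMF (X₁ × X₂)} {q : PMF ((X₁ × X₂) × (Z₁ × Z₂))}

theorem map_toReal_of_injective {Ω Ω' : Type*} [Fintype Ω] {f : Ω → Ω'}
    (hf : Function.Injective f) (p : PMF Ω) (ω : Ω) :
    ((p.map f) (f ω)).toReal = (p ω).toReal := by
  classical
  rw [map_toReal, Finset.sum_eq_single ω]
  · simp
  · intro b _ hb
    rw [ind_of_not fun h => hb (hf h), mul_zero]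
  · simp

theorem swap_separatelyGenerated (h : SeparatelyGenerated p q) :
    SeparatelyGenerated (p.map Prod.swap) (q.map (Prod.map Prod.swap Prod.swap)) := by
  have e1 : margX1Z1 (q.map (Prod.map Prod.swap Prod.swap)) = margX2Z2 q := by
    rw [margX1Z1, margX2Z2, PMF.map_comp]; rfl
  have e2 : margX2Z2 (q.map (Prod.map Prod.swap Prod.swap)) = margX1Z1 q := by
    rw [margX1Z1, margX2Z2, PMF.map_comp]; rfl
  refine ⟨?_, fun x₂ x₁ z₂ z₁ => ?_⟩
  · rw [← h.1, PMF.map_comp, PMF.map_comp]; rfl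
  · rw [e1, e2]
    have h1 := map_toReal_of_injective (f := Prod.map (Prod.swap (α := X₁) (β := X₂))
      (Prod.swap (α := Z₁) (β := Z₂))) (Prod.swap_injective.prodMap Prod.swap_injective) q
      ((x₁, x₂), (z₁, z₂))
    have h2 := map_toReal_of_injective (Prod.swap_injective (α := X₁) (β := X₂)) p (x₁, x₂)
    simp only [Prod.map_apply, Prod.swap_prod_mk] at h1 h2
    rw [h1, h2, h.2]
    ring

theorem infoDensity_map_swap {α β : Type*} [Fintype α] [Fintype β] (n : ℕ) (r : PMF (α × β))
    (z : α × β) : infoDensity n (r.map Prod.swap) z.swap = infoDensity n r z := by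
  have e1 : (r.map Prod.swap).map Prod.fst = r.map Prod.snd := by rw [PMF.map_comp]; rfl
  have e2 : (r.map Prod.swap).map Prod.snd = r.map Prod.fst := by rw [PMF.map_comp]; rfl
  unfold infoDensity
  rw [e1, e2, map_toReal_of_injective Prod.swap_injective, Prod.fst_swap, Prod.snd_swap,
    mul_comm ((r.map Prod.snd z.2).toReal)]

theorem one_le_expect_infoDensity_add' (h : SeparatelyGenerated p q) {n : ℕ} (hn : 1 ≤ n)
    (a b : ℝ) :
    1 ≤ expect (margX2Z2 q) (fun t => ind (a < infoDensity n (margX2Z2 q) t)) +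
      expect (margZ1Z2 q) (fun z => ind (infoDensity n (margZ1Z2 q) z < b)) +
      Real.exp (n * a) * (Real.exp (n * b))⁻¹ := by
  have h1 := one_le_expect_infoDensity_add (swap_separatelyGenerated h) hn a b
  have e1 : margX1Z1 (q.map (Prod.map Prod.swap Prod.swap)) = margX2Z2 q := by
    rw [margX1Z1, margX2Z2, PMF.map_comp]; rfl
  have e2 : margZ1Z2 (q.map (Prod.map Prod.swap Prod.swap)) = (margZ1Z2 q).map Prod.swap := by
    rw [margZ1Z2, margZ1Z2, PMF.map_comp, PMF.map_comp]; rfl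
  rw [e1, e2, expect_map] at h1
  simpa only [infoDensity_map_swap] using h1

end Swap

/-! ### Spectral rates, diagonal choice and encoder rates. -/

section Asymptotics

theorem tendsto_exp_neg_nat_mul {ε : ℝ} (hε : 0 < ε) :
    Tendsto (fun n : ℕ => Real.exp (-(n * ε))) atTop (𝓝 0) :=
  Real.tendsto_exp_neg_atTop_nhds_zero.comp
    (tendsto_natCast_atTop_atTop.atTop_mul_const hε)

theorem pLimsup_le_of_forall_gt {Ω : ℕ → Type*} [∀ n, Fintype (Ω n)]
    {p : (n : ℕ) → PMF (Ω n)} {Z : (n : ℕ) → Ω n → ℝ} {R : ℝ}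
    (h : ∀ a, R < a → Tendsto (fun n => expect (p n) (fun ω => ind (a < Z n ω))) atTop (𝓝 0)) :
    pLimsup p Z ≤ R :=
  EReal.le_of_forall_lt_iff_le.1 fun a ha =>
    pLimsup_le_of_tendsto (h a (EReal.coe_lt_coe_iff.1 ha))

/-- The density falls below `-a` with probability at most `exp (-n a)`, which vanishes for every `a
> 0`. -/
theorem infInfoRate_nonneg {α β : ℕ → Type*} [∀ n, Fintype (α n)] [∀ n, Fintype (β n)]
    (p : (n : ℕ) → PMF (α n × β n)) : 0 ≤ infInfoRate p := by
  have h : pLimsup p (fun n ω => -infoDensity n (p n) ω) ≤ ((0 : ℝ) : EReal) := by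
    refine pLimsup_le_of_forall_gt fun a ha => ?_
    refine squeeze_zero' (Eventually.of_forall fun n => expect_nonneg fun ω => ind_nonneg _) ?_
      (tendsto_exp_neg_nat_mul ha)
    filter_upwards [eventually_ge_atTop 1] with n hn
    have := expect_infoDensity_lt_le hn (p n) (-a)
    simp only [lt_neg, mul_neg] at this ⊢
    exact this
  rw [infInfoRate, pLiminf, EReal.le_neg]
  simpa using h

/-- Keeps the spectral rates finite: `𝒳ⁿ` has `exp (n log |𝒳|)` elements, so the tail above `a` is
at most `exp (-n (a - log |𝒳|))`. -/
theorem supInfoRate_le_log_card {𝒳 : Type*} [Fintype 𝒳] [Nonempty 𝒳] {β : ℕ → Type*}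
    [∀ n, Fintype (β n)] (p : (n : ℕ) → PMF ((Fin n → 𝒳) × β n)) :
    supInfoRate p ≤ (Real.log (Fintype.card 𝒳) : ℝ) := by
  refine pLimsup_le_of_forall_gt fun a ha => ?_
  refine squeeze_zero' (Eventually.of_forall fun n => expect_nonneg fun ω => ind_nonneg _) ?_
    (tendsto_exp_neg_nat_mul (sub_pos.2 ha))
  filter_upwards [eventually_ge_atTop 1] with n hn
  refine (expect_lt_infoDensity_le_card_fst hn (p n) a).trans (le_of_eq ?_)
  have hc : (0 : ℝ) < Fintype.card 𝒳 := by exact_mod_cast Fintype.card_pos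
  rw [Fintype.card_pi_const, Nat.cast_pow, ← Real.exp_log (pow_pos hc n), Real.log_pow,
    ← Real.exp_add]
  congr 1; ring

theorem tendsto_of_lt_infInfoRate {α β : ℕ → Type*} [∀ n, Fintype (α n)] [∀ n, Fintype (β n)]
    {p : (n : ℕ) → PMF (α n × β n)} {b : ℝ} (h : (b : EReal) < infInfoRate p) :
    Tendsto (fun n => expect (p n) (fun ω => ind (infoDensity n (p n) ω < b))) atTop (𝓝 0) := by
  rw [infInfoRate, pLiminf, EReal.lt_neg_comm, ← EReal.coe_neg] at h
  simpa only [neg_lt_neg_iff] using tendsto_of_pLimsup_lt h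

/-- Comparison of spectral rates from a bound of data-processing type. -/
theorem infInfoRate_le_supInfoRate {α β γ δ : ℕ → Type*} [∀ n, Fintype (α n)]
    [∀ n, Fintype (β n)] [∀ n, Fintype (γ n)] [∀ n, Fintype (δ n)]
    {p : (n : ℕ) → PMF (α n × β n)} {r : (n : ℕ) → PMF (γ n × δ n)}
    (h : ∀ n : ℕ, 1 ≤ n → ∀ a b : ℝ,
      1 ≤ expect (p n) (fun t => ind (a < infoDensity n (p n) t)) +
        expect (r n) (fun z => ind (infoDensity n (r n) z < b)) +
        Real.exp (n * a) * (Real.exp (n * b))⁻¹) :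
    infInfoRate r ≤ supInfoRate p := by
  by_contra! hlt
  -- With `a < b` strictly between the two rates, all three terms bounding `1` would tend to zero.
  obtain ⟨a, ha1, ha2⟩ := EReal.lt_iff_exists_real_btwn.1 hlt
  obtain ⟨b, hb1, hb2⟩ := EReal.lt_iff_exists_real_btwn.1 ha2
  have hab : a < b := EReal.coe_lt_coe_iff.1 hb1
  have h1 := tendsto_of_pLimsup_lt ha1
  have h2 := tendsto_of_lt_infInfoRate hb2
  have h3 := tendsto_exp_neg_nat_mul (sub_pos.2 hab)
  have h4 := (h1.add h2).add h3
  rw [add_zero, add_zero] at h4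
  refine absurd (ge_of_tendsto h4 ?_) (not_le.2 (zero_lt_one (α := ℝ)))
  filter_upwards [eventually_ge_atTop 1] with n hn
  refine (h n hn a b).trans (le_of_eq ?_)
  congr 1
  rw [← Real.exp_neg, ← Real.exp_add]
  congr 1; ring

/-- Diagonal choice of a sequence whose tolerance tends to zero. -/
theorem exists_seq_of_forall_eventually_exists {C : ℕ → Type*} [∀ n, Nonempty (C n)]
    {A : (n : ℕ) → ℝ → C n → Prop} (hmono : ∀ n ε ε' c, ε ≤ ε' → A n ε c → A n ε' c)
    (h : ∀ ε > 0, ∀ᶠ n in atTop, ∃ c, A n ε c) :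
    ∃ c : (n : ℕ) → C n, ∀ ε > 0, ∀ᶠ n in atTop, A n ε (c n) := by
  classical
  -- At length `n` the smallest attainable tolerance `1 / (k + 1)` with `k ≤ n` is used; if none is
  -- attainable the choice is arbitrary.
  set S : ℕ → ℕ → Prop := fun n k => ∃ c, A n (1 / ((k : ℝ) + 1)) c with hS
  have hch : ∀ n, ∃ c, S n (Nat.findGreatest (S n) n) →
      A n (1 / ((Nat.findGreatest (S n) n : ℝ) + 1)) c := by
    intro n
    by_cases hs : S n (Nat.findGreatest (S n) n)
    · obtain ⟨c, hc⟩ := hs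
      exact ⟨c, fun _ => hc⟩
    · exact ⟨Classical.arbitrary _, fun h' => absurd h' hs⟩
  choose c hc using hch
  refine ⟨c, fun ε hε => ?_⟩
  obtain ⟨k, hk⟩ := exists_nat_one_div_lt hε
  filter_upwards [h (1 / ((k : ℝ) + 1)) (by positivity), eventually_ge_atTop k] with n hn hkn
  refine hmono n _ ε _ ?_ (hc n (Nat.findGreatest_spec (P := S n) hkn hn))
  refine le_trans ?_ hk.le
  have : k ≤ Nat.findGreatest (S n) n := Nat.le_findGreatest hkn hn
  gcongr

theorem limsup_coe_le_of_forall {u : ℕ → ℝ} {R : ℝ}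
    (h : ∀ ε > 0, ∀ᶠ n in atTop, u n ≤ R + ε) :
    limsup (fun n => (u n : EReal)) atTop ≤ (R : EReal) := by
  refine EReal.le_of_forall_lt_iff_le.1 fun a ha => limsup_le_of_le (by isBoundedDefault) ?_
  filter_upwards [h (a - R) (sub_pos.2 (EReal.coe_lt_coe_iff.1 ha))] with n hn
  exact EReal.coe_le_coe_iff.2 (by linarith)

theorem eventually_lt_of_limsup_coe_le {u : ℕ → ℝ} {R : ℝ}
    (h : limsup (fun n => (u n : EReal)) atTop ≤ (R : EReal)) {ε : ℝ} (hε : 0 < ε) :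
    ∀ᶠ n in atTop, u n < R + ε := by
  have h1 : limsup (fun n => (u n : EReal)) atTop < ((R + ε : ℝ) : EReal) :=
    h.trans_lt (EReal.coe_lt_coe_iff.2 (by linarith))
  filter_upwards [eventually_lt_of_limsup_lt h1] with n hn
  exact EReal.coe_lt_coe_iff.1 hn

/-- For `x ≥ 0` rounding up at most doubles `exp x`; in a rate this costs `log 2 / n`. -/
theorem exists_nat_between_exp {x : ℝ} (hx : 0 ≤ x) :
    ∃ M : ℕ, 0 < M ∧ Real.exp x ≤ M ∧ (M : ℝ) ≤ 2 * Real.exp x := by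
  refine ⟨⌈Real.exp x⌉₊, Nat.ceil_pos.2 (Real.exp_pos x), Nat.le_ceil _, ?_⟩
  have h1 := Nat.ceil_lt_add_one (Real.exp_pos x).le
  have h2 := Real.one_le_exp hx
  linarith

theorem rate_le {α : Type*} [Nonempty α] {n B : ℕ} (hn : 1 ≤ n) {x : ℝ}
    (hB : (B : ℝ) ≤ 2 * Real.exp (n * x)) (φ : α → Fin B) :
    rate n φ ≤ x + Real.log 2 / n := by
  have hn' : (0 : ℝ) < n := by exact_mod_cast hn
  have h1 : (Set.range φ).ncard ≤ B := by
    simpa using Set.ncard_le_card (Set.range φ)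
  have h2 : 0 < (Set.range φ).ncard := (Set.ncard_pos).2 (Set.range_nonempty φ)
  unfold rate
  rw [div_le_iff₀ hn', add_mul, div_mul_cancel₀ _ hn'.ne']
  have h3 : Real.log ((Set.range φ).ncard : ℝ) ≤ Real.log (2 * Real.exp (n * x)) :=
    Real.log_le_log (by exact_mod_cast h2) (le_trans (by exact_mod_cast h1) hB)
  rw [Real.log_mul (by norm_num) (Real.exp_pos _).ne', Real.log_exp] at h3
  linarith

end Asymptotics

/-! ### Converse: deterministic descriptions. -/

section Converse

/-- The joint law of two sources and of deterministic separate descriptions of them. -/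
noncomputable def encodedLaw {X₁ X₂ Z₁ Z₂ : Type*} (p : PMF (X₁ × X₂)) (φ₁ : X₁ → Z₁)
    (φ₂ : X₂ → Z₂) : PMF ((X₁ × X₂) × (Z₁ × Z₂)) :=
  p.map fun x => (x, (φ₁ x.1, φ₂ x.2))

variable {X₁ X₂ Z₁ Z₂ : Type*} [Fintype X₁] [Fintype X₂] [Fintype Z₁] [Fintype Z₂]

/-- Positive mass at `x` matters: `condProb` vanishes at null points. -/
theorem condProb_map_graph {X Z : Type*} [Fintype X] [Fintype Z] (p : PMF X) (φ : X → Z) {x : X}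
    (hx : 0 < (p x).toReal) (z : Z) :
    condProb (p.map fun x => (x, φ x)) z x = ind (φ x = z) := by
  classical
  have e : (p.map fun x => (x, φ x)).map Prod.fst = p := by
    rw [PMF.map_comp]; exact PMF.map_id p
  rw [condProb, e, map_toReal, Finset.sum_eq_single x]
  · by_cases h : φ x = z
    · rw [ind_of h, ind_of (by rw [h]), mul_one, div_self hx.ne']
    · rw [ind_of_not h, ind_of_not (by simpa using h)]; simp
  · intro b _ hb
    rw [ind_of_not (by simp [hb]), mul_zero]
  · simp

theorem encodedLaw_separatelyGenerated (p : PMF (X₁ × X₂)) (φ₁ : X₁ → Z₁) (φ₂ : X₂ → Z₂) :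
    SeparatelyGenerated p (encodedLaw p φ₁ φ₂) := by
  classical
  refine ⟨?_, fun x₁ x₂ z₁ z₂ => ?_⟩
  · rw [encodedLaw, PMF.map_comp]; exact PMF.map_id p
  have e1 : margX1Z1 (encodedLaw p φ₁ φ₂) = (p.map Prod.fst).map fun x => (x, φ₁ x) := by
    rw [margX1Z1, encodedLaw, PMF.map_comp, PMF.map_comp]; rfl
  have e2 : margX2Z2 (encodedLaw p φ₁ φ₂) = (p.map Prod.snd).map fun x => (x, φ₂ x) := by
    rw [margX2Z2, encodedLaw, PMF.map_comp, PMF.map_comp]; rfl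
  have e3 : (encodedLaw p φ₁ φ₂ ((x₁, x₂), (z₁, z₂))).toReal =
      (p (x₁, x₂)).toReal * ind (φ₁ x₁ = z₁ ∧ φ₂ x₂ = z₂) := by
    rw [encodedLaw, map_toReal, Finset.sum_eq_single (x₁, x₂)]
    · simp
    · intro b _ hb
      rw [ind_of_not (by simp [hb]), mul_zero]
    · simp
  rw [e3]
  rcases (ENNReal.toReal_nonneg (a := p (x₁, x₂))).eq_or_lt with h | h
  · rw [← h]; simp
  · rw [e1, e2, condProb_map_graph _ _ (h.trans_le (le_map_fst p x₁ x₂)),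
      condProb_map_graph _ _ (h.trans_le (le_map_snd p x₁ x₂)), mul_assoc]
    congr 1
    by_cases h1 : φ₁ x₁ = z₁ <;> by_cases h2 : φ₂ x₂ = z₂ <;> simp [h1, h2]

/-- The spectral sup-mutual information rate between a source and a deterministic description
is at most the rate of the description. -/
theorem supInfoRate_map_graph_le {α β : ℕ → Type*} [∀ n, Fintype (α n)] [∀ n, Fintype (β n)]
    (p : (n : ℕ) → PMF (α n)) (φ : (n : ℕ) → α n → β n) {R : ℝ}
    (hR : limsup (fun n => ((rate n (φ n) : ℝ) : EReal)) atTop ≤ (R : EReal)) :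
    supInfoRate (fun n => (p n).map fun x => (x, φ n x)) ≤ R := by
  classical
  refine pLimsup_le_of_forall_gt fun a ha => ?_
  -- Half the gap is spent on the size of the range of `φ n`, at most `exp (n * (R + (a - R) / 2))`;
  -- the other half remains as exponential decay.
  have hε : 0 < (a - R) / 2 := by linarith
  refine squeeze_zero' (Eventually.of_forall fun n => expect_nonneg fun ω => ind_nonneg _) ?_
    (tendsto_exp_neg_nat_mul hε)
  filter_upwards [eventually_ge_atTop 1, eventually_lt_of_limsup_coe_le hR hε] with n hn hr
  have hn' : (0 : ℝ) < n := by exact_mod_cast hn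
  refine (expect_lt_infoDensity_le_card_snd hn _ a (Finset.univ.image (φ n)) ?_).trans ?_
  · intro w hw
    rw [PMF.map_comp, map_toReal]
    refine Finset.sum_eq_zero fun x _ => ?_
    rw [ind_of_not, mul_zero]
    rintro rfl
    exact hw (Finset.mem_image_of_mem _ (Finset.mem_univ x))
  · have hc : ((Finset.univ.image (φ n)).card : ℝ) ≤ Real.exp (n * (R + (a - R) / 2)) := by
      have e : (Set.range (φ n)).ncard = (Finset.univ.image (φ n)).card := by
        rw [← Set.ncard_coe_finset, Finset.coe_image, Finset.coe_univ, Set.image_univ]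
      rw [rate, e, div_lt_iff₀ hn'] at hr
      rcases Nat.eq_zero_or_pos (Finset.univ.image (φ n)).card with h0 | h0
      · rw [h0]; simp [Real.exp_nonneg]
      · rw [← Real.log_le_iff_le_exp (by exact_mod_cast h0)]
        linarith
    refine (mul_le_mul_of_nonneg_right hc (Real.exp_pos _).le).trans (le_of_eq ?_)
    rw [← Real.exp_add]
    congr 1; ring

end Converse

/-! ### Achievability: choice of sizes and error exponents. -/

section Achievability

/-- Existence, for large block lengths, of codes close to a rate region described by separately
generated auxiliary random variables. -/
theorem eventually_exists_code {𝒳₁ 𝒳₂ 𝒴₁ 𝒴₂ : Type*} [Fintype 𝒳₁] [Fintype 𝒳₂]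
    {P : SourcePair 𝒳₁ 𝒳₂} {d : Distortion 𝒳₁ 𝒳₂ 𝒴₁ 𝒴₂} (hd : d.Bounded) {R₁ R₂ D : ℝ}
    {𝒵₁ 𝒵₂ : ℕ → Type*} [∀ n, Fintype (𝒵₁ n)] [∀ n, Fintype (𝒵₂ n)]
    {Q : (n : ℕ) → PMF (((Fin n → 𝒳₁) × (Fin n → 𝒳₂)) × (𝒵₁ n × 𝒵₂ n))}
    {h₁ : (n : ℕ) → 𝒵₁ n × 𝒵₂ n → (Fin n → 𝒴₁)} {h₂ : (n : ℕ) → 𝒵₁ n × 𝒵₂ n → (Fin n → 𝒴₂)}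
    (hQ : ∀ n : ℕ, 1 ≤ n → SeparatelyGenerated (P n) (Q n))
    (hD : limsup (fun n => ((expect (Q n) (fun t =>
            (d n t.1.1 t.1.2 (h₁ n t.2) (h₂ n t.2) : ℝ)) : ℝ) : EReal)) atTop ≤ (D : EReal))
    (hR₁0 : 0 ≤ R₁) (hR₂0 : 0 ≤ R₂) {ε : ℝ} (hε : 0 < ε) {a₁ a₂ b : ℝ} (ha₁0 : 0 ≤ a₁)
    (ha₂0 : 0 ≤ a₂)
    (ha₁ : Tendsto (fun n => expect (margX1Z1 (Q n))
      (fun t => ind (a₁ < infoDensity n (margX1Z1 (Q n)) t))) atTop (𝓝 0))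
    (ha₂ : Tendsto (fun n => expect (margX2Z2 (Q n))
      (fun t => ind (a₂ < infoDensity n (margX2Z2 (Q n)) t))) atTop (𝓝 0))
    (hb : Tendsto (fun n => expect (margZ1Z2 (Q n))
      (fun z => ind (infoDensity n (margZ1Z2 (Q n)) z < b))) atTop (𝓝 0))
    (hR₁ : a₁ - b ≤ R₁ + 2 * ε) (hR₂ : a₂ - b ≤ R₂ + 2 * ε)
    (hR : a₁ + a₂ - b ≤ R₁ + R₂ + 3 * ε) :
    ∀ᶠ n in atTop, ∃ c : Code 𝒳₁ 𝒳₂ 𝒴₁ 𝒴₂ n,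
      rate n c.φ₁ ≤ R₁ + 5 * ε ∧ rate n c.φ₂ ≤ R₂ + 5 * ε ∧
      expect (P n) (fun x => (d n x.1 x.2 (c.ψ₁ (c.φ₁ x.1, c.φ₂ x.2))
        (c.ψ₂ (c.φ₁ x.1, c.φ₂ x.2)) : ℝ)) ≤ D + 2 * ε := by
  obtain ⟨D₀, hD₀⟩ := hd
  have herr : Tendsto (fun n : ℕ => (D₀ : ℝ) * (expect (margZ1Z2 (Q n))
      (fun z => ind (infoDensity n (margZ1Z2 (Q n)) z < b)) +
      3 * expect (margX1Z1 (Q n)) (fun t => ind (a₁ < infoDensity n (margX1Z1 (Q n)) t)) +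
      3 * expect (margX2Z2 (Q n)) (fun t => ind (a₂ < infoDensity n (margX2Z2 (Q n)) t)) +
      -- `10 = 1 + 1 + 4 + 2 + 2`: two covering failures, collisions of both indices, collisions of
      -- a single index.
      10 * Real.exp (-(n * ε)))) atTop (𝓝 0) := by
    have := (((hb.add (ha₁.const_mul 3)).add (ha₂.const_mul 3)).add
      ((tendsto_exp_neg_nat_mul hε).const_mul 10)).const_mul (D₀ : ℝ)
    simpa using this
  have hlog : Tendsto (fun n : ℕ => Real.log 2 / (n : ℝ)) atTop (𝓝 0) :=
    tendsto_const_div_atTop_nhds_zero_nat _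
  filter_upwards [eventually_ge_atTop 1, eventually_lt_of_limsup_coe_le hD hε,
    herr.eventually_lt_const hε, hlog.eventually_lt_const hε] with n hn hDn herrn hlogn
  have hn' : (0 : ℝ) < n := by exact_mod_cast hn
  have hnε : 0 < n * ε := mul_pos hn' hε
  -- Codebooks exceed the covering threshold by `ε` in rate. Bins at `4 * ε` above `R_m` leave a
  -- margin `ε` in every packing exponent, and `log 2 / n < ε` makes the encoder rates at most `R_m
  -- + 5 * ε`.
  obtain ⟨M₁, hM₁0, hM₁l, hM₁u⟩ := exists_nat_between_exp
    (show 0 ≤ n * (a₁ + ε) by positivity)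
  obtain ⟨M₂, hM₂0, hM₂l, hM₂u⟩ := exists_nat_between_exp
    (show 0 ≤ n * (a₂ + ε) by positivity)
  obtain ⟨B₁, hB₁0, hB₁l, hB₁u⟩ := exists_nat_between_exp
    (show 0 ≤ n * (R₁ + 4 * ε) by positivity)
  obtain ⟨B₂, hB₂0, hB₂l, hB₂u⟩ := exists_nat_between_exp
    (show 0 ≤ n * (R₂ + 4 * ε) by positivity)
  obtain ⟨φ₁, φ₂, dec, hc⟩ := exists_code_expect_le (hQ n hn) hn a₁ a₂ b
    hM₁0 hM₂0 hB₁0 hB₂0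
    (d := fun x z => (d n x.1 x.2 (h₁ n z) (h₂ n z) : ℝ)) (D₀ := (D₀ : ℝ))
    (fun x z => NNReal.coe_nonneg _) (fun x z => NNReal.coe_le_coe.2 (hD₀ n hn _ _ _ _))
    (NNReal.coe_nonneg _)
  have hX : Nonempty ((Fin n → 𝒳₁) × (Fin n → 𝒳₂)) := (P n).support_nonempty.to_type
  have : Nonempty (Fin n → 𝒳₁) := hX.map Prod.fst
  have : Nonempty (Fin n → 𝒳₂) := hX.map Prod.snd
  refine ⟨⟨B₁, B₂, φ₁, φ₂, fun b => h₁ n (dec b), fun b => h₂ n (dec b)⟩, ?_, ?_, ?_⟩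
  · have := rate_le hn hB₁u φ₁
    linarith
  · have := rate_le hn hB₂u φ₂
    linarith
  -- Here `M / exp (n a) ≥ exp (n ε) ≥ n ε`: the failure is doubly exponentially small, but a single
  -- exponential suffices.
  · have hcover : ∀ {a : ℝ} {M : ℕ}, Real.exp (n * (a + ε)) ≤ M →
        Real.exp (-(M / Real.exp (n * a))) ≤ Real.exp (-(n * ε)) := by
      intro a M hM
      rw [Real.exp_le_exp, neg_le_neg_iff, le_div_iff₀ (Real.exp_pos _)]
      refine le_trans ?_ hM
      rw [mul_add, Real.exp_add, mul_comm]
      have := Real.add_one_le_exp (n * ε)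
      exact mul_le_mul_of_nonneg_left (by linarith) (Real.exp_pos _).le
    have hpack : ∀ {a R : ℝ} {M B : ℕ}, (M : ℝ) ≤ 2 * Real.exp (n * (a + ε)) →
        Real.exp (n * (R + 4 * ε)) ≤ B → a - b ≤ R + 2 * ε →
        M * (Real.exp (n * b))⁻¹ / B ≤ 2 * Real.exp (-(n * ε)) := by
      intro a R M B hM hB hab
      rw [div_le_iff₀ ((Real.exp_pos _).trans_le hB), ← Real.exp_neg]
      calc M * Real.exp (-(n * b)) ≤ 2 * Real.exp (n * (a + ε)) * Real.exp (-(n * b)) := by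
            gcongr
        _ = 2 * Real.exp (n * (a - b + ε)) := by
            rw [mul_assoc, ← Real.exp_add]; congr 2; ring
        _ ≤ 2 * Real.exp (n * (R + 3 * ε)) := by
            refine mul_le_mul_of_nonneg_left (Real.exp_le_exp.2
              (mul_le_mul_of_nonneg_left ?_ hn'.le)) (by norm_num)
            linarith
        _ = 2 * Real.exp (-(n * ε)) * Real.exp (n * (R + 4 * ε)) := by
            rw [mul_assoc, ← Real.exp_add]; congr 2; ring
        _ ≤ _ := by gcongr
    have hpair : M₁ * M₂ * (Real.exp (n * b))⁻¹ / (B₁ * B₂) ≤ 4 * Real.exp (-(n * ε)) := by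
      rw [div_le_iff₀ (mul_pos ((Real.exp_pos _).trans_le hB₁l) ((Real.exp_pos _).trans_le hB₂l)),
        ← Real.exp_neg]
      calc M₁ * M₂ * Real.exp (-(n * b)) ≤ 2 * Real.exp (n * (a₁ + ε)) *
            (2 * Real.exp (n * (a₂ + ε))) * Real.exp (-(n * b)) := by gcongr
        _ = 4 * Real.exp (n * (a₁ + a₂ - b + 2 * ε)) := by
            have : n * (a₁ + a₂ - b + 2 * ε) = n * (a₁ + ε) + n * (a₂ + ε) + -(n * b) := by ring
            rw [this, Real.exp_add, Real.exp_add]; ring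
        _ ≤ 4 * Real.exp (n * (R₁ + R₂ + 7 * ε)) := by
            refine mul_le_mul_of_nonneg_left (Real.exp_le_exp.2
              (mul_le_mul_of_nonneg_left ?_ hn'.le)) (by norm_num)
            linarith
        _ = 4 * Real.exp (-(n * ε)) *
            (Real.exp (n * (R₁ + 4 * ε)) * Real.exp (n * (R₂ + 4 * ε))) := by
            rw [mul_assoc, ← Real.exp_add, ← Real.exp_add]; congr 2; ring
        _ ≤ _ := by gcongr
    have e1 := hcover hM₁l
    have e2 := hcover hM₂l
    have e3 := hpack hM₂u hB₂l hR₂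
    have e4 := hpack hM₁u hB₁l hR₁
    refine hc.trans ?_
    have e5 := mul_le_mul_of_nonneg_left (a := (D₀ : ℝ))
      (add_le_add (add_le_add (add_le_add (add_le_add e1 e2) hpair) e3) e4) (NNReal.coe_nonneg _)
    linarith

end Achievability

/-! ### The two implications. -/

theorem exists_auxiliary_of_faAchievable {𝒳₁ 𝒳₂ 𝒴₁ 𝒴₂ : Type*} [Fintype 𝒳₁] [Fintype 𝒳₂]
    {P : SourcePair 𝒳₁ 𝒳₂} {d : Distortion 𝒳₁ 𝒳₂ 𝒴₁ 𝒴₂} {R₁ R₂ D : ℝ}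
    (h : FaAchievable P d R₁ R₂ D) :
    ∃ (𝒵₁ 𝒵₂ : ℕ → Type) (_ : ∀ n, Fintype (𝒵₁ n)) (_ : ∀ n, Fintype (𝒵₂ n))
        (Q : (n : ℕ) → PMF (((Fin n → 𝒳₁) × (Fin n → 𝒳₂)) × (𝒵₁ n × 𝒵₂ n)))
        (h₁ : (n : ℕ) → 𝒵₁ n × 𝒵₂ n → (Fin n → 𝒴₁))
        (h₂ : (n : ℕ) → 𝒵₁ n × 𝒵₂ n → (Fin n → 𝒴₂)),
        (∀ n : ℕ, 1 ≤ n → SeparatelyGenerated (P n) (Q n)) ∧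
        limsup (fun n => ((expect (Q n) (fun t =>
            (d n t.1.1 t.1.2 (h₁ n t.2) (h₂ n t.2) : ℝ)) : ℝ) : EReal)) atTop ≤ (D : EReal) ∧
        supInfoRate (fun n => margX1Z1 (Q n)) - infInfoRate (fun n => margZ1Z2 (Q n))
          ≤ (R₁ : EReal) ∧
        supInfoRate (fun n => margX2Z2 (Q n)) - infInfoRate (fun n => margZ1Z2 (Q n))
          ≤ (R₂ : EReal) ∧
        supInfoRate (fun n => margX1Z1 (Q n)) + supInfoRate (fun n => margX2Z2 (Q n))
            - infInfoRate (fun n => margZ1Z2 (Q n))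
          ≤ ((R₁ + R₂ : ℝ) : EReal) := by
  obtain ⟨c, hc₁, hc₂, hcD⟩ := h
  refine ⟨fun n => Fin (c n).L₁, fun n => Fin (c n).L₂, fun n => inferInstance,
    fun n => inferInstance, fun n => encodedLaw (P n) (c n).φ₁ (c n).φ₂, fun n => (c n).ψ₁,
    fun n => (c n).ψ₂, fun n _ => encodedLaw_separatelyGenerated _ _ _, ?_, ?_⟩
  · simpa only [encodedLaw, expect_map] using hcD
  have e1 : ∀ n, margX1Z1 (encodedLaw (P n) (c n).φ₁ (c n).φ₂) =
      ((P n).map Prod.fst).map fun x => (x, (c n).φ₁ x) := fun n => by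
    rw [margX1Z1, encodedLaw, PMF.map_comp, PMF.map_comp]; rfl
  have e2 : ∀ n, margX2Z2 (encodedLaw (P n) (c n).φ₁ (c n).φ₂) =
      ((P n).map Prod.snd).map fun x => (x, (c n).φ₂ x) := fun n => by
    rw [margX2Z2, encodedLaw, PMF.map_comp, PMF.map_comp]; rfl
  have h1 : supInfoRate (fun n => margX1Z1 (encodedLaw (P n) (c n).φ₁ (c n).φ₂)) ≤ R₁ := by
    simp_rw [e1]
    exact supInfoRate_map_graph_le _ (fun n => (c n).φ₁) hc₁
  have h2 : supInfoRate (fun n => margX2Z2 (encodedLaw (P n) (c n).φ₁ (c n).φ₂)) ≤ R₂ := by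
    simp_rw [e2]
    exact supInfoRate_map_graph_le _ (fun n => (c n).φ₂) hc₂
  have h3 := EReal.neg_le_zero.2
    (infInfoRate_nonneg (fun n => margZ1Z2 (encodedLaw (P n) (c n).φ₁ (c n).φ₂)))
  refine ⟨?_, ?_, ?_⟩
  · simpa [sub_eq_add_neg] using add_le_add h1 h3
  · simpa [sub_eq_add_neg] using add_le_add h2 h3
  · simpa [sub_eq_add_neg] using add_le_add (add_le_add h1 h2) h3

theorem faAchievable_of_auxiliary {𝒳₁ 𝒳₂ 𝒴₁ 𝒴₂ : Type*} [Fintype 𝒳₁] [Fintype 𝒳₂]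
    {P : SourcePair 𝒳₁ 𝒳₂} {d : Distortion 𝒳₁ 𝒳₂ 𝒴₁ 𝒴₂} (hd : d.Bounded) {R₁ R₂ D : ℝ}
    {𝒵₁ 𝒵₂ : ℕ → Type*} [∀ n, Fintype (𝒵₁ n)] [∀ n, Fintype (𝒵₂ n)]
    {Q : (n : ℕ) → PMF (((Fin n → 𝒳₁) × (Fin n → 𝒳₂)) × (𝒵₁ n × 𝒵₂ n))}
    {h₁ : (n : ℕ) → 𝒵₁ n × 𝒵₂ n → (Fin n → 𝒴₁)} {h₂ : (n : ℕ) → 𝒵₁ n × 𝒵₂ n → (Fin n → 𝒴₂)}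
    (hQ : ∀ n : ℕ, 1 ≤ n → SeparatelyGenerated (P n) (Q n))
    (hD : limsup (fun n => ((expect (Q n) (fun t =>
            (d n t.1.1 t.1.2 (h₁ n t.2) (h₂ n t.2) : ℝ)) : ℝ) : EReal)) atTop ≤ (D : EReal))
    (hR₁ : supInfoRate (fun n => margX1Z1 (Q n)) - infInfoRate (fun n => margZ1Z2 (Q n))
          ≤ (R₁ : EReal))
    (hR₂ : supInfoRate (fun n => margX2Z2 (Q n)) - infInfoRate (fun n => margZ1Z2 (Q n))
          ≤ (R₂ : EReal))
    (hR : supInfoRate (fun n => margX1Z1 (Q n)) + supInfoRate (fun n => margX2Z2 (Q n))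
            - infInfoRate (fun n => margZ1Z2 (Q n))
          ≤ ((R₁ + R₂ : ℝ) : EReal)) :
    FaAchievable P d R₁ R₂ D := by
  -- A law on blocks of length one provides a letter in each alphabet.
  obtain ⟨x₁, x₂⟩ := (P 1).support_nonempty.to_type.some
  have : Nonempty 𝒳₁ := ⟨x₁ 0⟩
  have : Nonempty 𝒳₂ := ⟨x₂ 0⟩
  have hi0 := infInfoRate_nonneg (fun n => margZ1Z2 (Q n))
  have hi₁ : infInfoRate (fun n => margZ1Z2 (Q n)) ≤ supInfoRate (fun n => margX1Z1 (Q n)) :=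
    infInfoRate_le_supInfoRate fun n hn a b => one_le_expect_infoDensity_add (hQ n hn) hn a b
  have hi₂ : infInfoRate (fun n => margZ1Z2 (Q n)) ≤ supInfoRate (fun n => margX2Z2 (Q n)) :=
    infInfoRate_le_supInfoRate fun n hn a b => one_le_expect_infoDensity_add' (hQ n hn) hn a b
  have hs₁ := supInfoRate_le_log_card (fun n => margX1Z1 (Q n))
  have hs₂ := supInfoRate_le_log_card (fun n => margX2Z2 (Q n))
  -- All three rates lie between `0` and a log-cardinality, so the `EReal` subtractions become real
  -- ones. Moreover `ι ≤ σ₁` and `ι ≤ σ₂` give `R₁, R₂ ≥ 0`, as the bin counts require.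
  have hreal : ∀ {s : EReal} {r : ℝ}, 0 ≤ s → s ≤ (r : EReal) → ∃ t : ℝ, s = t := by
    intro s r h0 h1
    refine ⟨s.toReal, (EReal.coe_toReal ?_ ?_).symm⟩
    · rintro rfl; exact absurd h1 (not_le.2 (EReal.coe_lt_top r))
    · rintro rfl; simp at h0
  obtain ⟨σ₁, hσ₁⟩ := hreal (hi0.trans hi₁) hs₁
  obtain ⟨σ₂, hσ₂⟩ := hreal (hi0.trans hi₂) hs₂
  obtain ⟨ι, hι⟩ := hreal hi0 (hi₁.trans hs₁)
  rw [hι] at hi0 hi₁ hi₂ hR₁ hR₂ hR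
  rw [hσ₁] at hi₁ hR₁ hR
  rw [hσ₂] at hi₂ hR₂ hR
  norm_cast at hi0 hi₁ hi₂ hR₁ hR₂ hR
  have hne : ∀ n, Nonempty (Code 𝒳₁ 𝒳₂ 𝒴₁ 𝒴₂ n) := by
    intro n
    obtain ⟨_, z⟩ := (Q n).support_nonempty.to_type.some
    exact ⟨⟨1, 1, fun _ => 0, fun _ => 0, fun _ => h₁ n z, fun _ => h₂ n z⟩⟩
  obtain ⟨c, hc⟩ := exists_seq_of_forall_eventually_exists
    (A := fun n ε (c : Code 𝒳₁ 𝒳₂ 𝒴₁ 𝒴₂ n) => rate n c.φ₁ ≤ R₁ + 5 * ε ∧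
      rate n c.φ₂ ≤ R₂ + 5 * ε ∧
      expect (P n) (fun x => (d n x.1 x.2 (c.ψ₁ (c.φ₁ x.1, c.φ₂ x.2))
        (c.ψ₂ (c.φ₁ x.1, c.φ₂ x.2)) : ℝ)) ≤ D + 2 * ε)
    (fun n ε ε' c hε hA => ⟨hA.1.trans (by linarith), hA.2.1.trans (by linarith),
      hA.2.2.trans (by linarith)⟩)
    (fun ε hε => eventually_exists_code hd hQ hD (by linarith) (by linarith) hε
      -- Thresholds strictly beyond the spectral rates make the three tails vanish; the differences
      -- exceed the rate bounds by `2 * ε`, and the sum by `3 * ε`.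
      (a₁ := σ₁ + ε) (a₂ := σ₂ + ε) (b := ι - ε) (by linarith) (by linarith)
      (tendsto_of_pLimsup_lt (by
        change supInfoRate (fun n => margX1Z1 (Q n)) < _
        rw [hσ₁]; exact EReal.coe_lt_coe_iff.2 (by linarith)))
      (tendsto_of_pLimsup_lt (by
        change supInfoRate (fun n => margX2Z2 (Q n)) < _
        rw [hσ₂]; exact EReal.coe_lt_coe_iff.2 (by linarith)))
      (tendsto_of_lt_infInfoRate (by
        rw [hι]; exact EReal.coe_lt_coe_iff.2 (by linarith)))
      (by linarith) (by linarith) (by linarith))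
  refine ⟨c, limsup_coe_le_of_forall fun ε hε => ?_, limsup_coe_le_of_forall fun ε hε => ?_,
    limsup_coe_le_of_forall fun ε hε => ?_⟩
  · filter_upwards [hc (ε / 5) (by positivity)] with n hn
    linarith [hn.1]
  · filter_upwards [hc (ε / 5) (by positivity)] with n hn
    linarith [hn.2.1]
  · filter_upwards [hc (ε / 2) (by positivity)] with n hn
    linarith [hn.2.2]

end MultiterminalCoding

theorem theorem1 {𝒳₁ 𝒳₂ 𝒴₁ 𝒴₂ : Type*} [Fintype 𝒳₁] [Fintype 𝒳₂]
    (P : MultiterminalCoding.SourcePair 𝒳₁ 𝒳₂)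
    (d : MultiterminalCoding.Distortion 𝒳₁ 𝒳₂ 𝒴₁ 𝒴₂) (hd : d.Bounded)
    (R₁ R₂ D : ℝ) :
    MultiterminalCoding.FaAchievable P d R₁ R₂ D ↔
      ∃ (𝒵₁ 𝒵₂ : ℕ → Type) (_ : ∀ n, Fintype (𝒵₁ n)) (_ : ∀ n, Fintype (𝒵₂ n))
        (Q : (n : ℕ) → PMF (((Fin n → 𝒳₁) × (Fin n → 𝒳₂)) × (𝒵₁ n × 𝒵₂ n)))
        (h₁ : (n : ℕ) → 𝒵₁ n × 𝒵₂ n → (Fin n → 𝒴₁))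
        (h₂ : (n : ℕ) → 𝒵₁ n × 𝒵₂ n → (Fin n → 𝒴₂)),
        (∀ n : ℕ, 1 ≤ n → MultiterminalCoding.SeparatelyGenerated (P n) (Q n)) ∧
        limsup (fun n => ((MultiterminalCoding.expect (Q n) (fun t =>
            (d n t.1.1 t.1.2 (h₁ n t.2) (h₂ n t.2) : ℝ)) : ℝ) : EReal)) atTop ≤ (D : EReal) ∧
        MultiterminalCoding.supInfoRate (fun n => MultiterminalCoding.margX1Z1 (Q n))
            - MultiterminalCoding.infInfoRate (fun n => MultiterminalCoding.margZ1Z2 (Q n))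
          ≤ (R₁ : EReal) ∧
        MultiterminalCoding.supInfoRate (fun n => MultiterminalCoding.margX2Z2 (Q n))
            - MultiterminalCoding.infInfoRate (fun n => MultiterminalCoding.margZ1Z2 (Q n))
          ≤ (R₂ : EReal) ∧
        MultiterminalCoding.supInfoRate (fun n => MultiterminalCoding.margX1Z1 (Q n))
            + MultiterminalCoding.supInfoRate (fun n => MultiterminalCoding.margX2Z2 (Q n))
            - MultiterminalCoding.infInfoRate (fun n => MultiterminalCoding.margZ1Z2 (Q n))
          ≤ ((R₁ + R₂ : ℝ) : EReal) := by
  constructor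
  · exact MultiterminalCoding.exists_auxiliary_of_faAchievable
  · rintro ⟨𝒵₁, 𝒵₂, _, _, Q, h₁, h₂, hQ, hD, hR₁, hR₂, hR⟩
    exact MultiterminalCoding.faAchievable_of_auxiliary hd hQ hD hR₁ hR₂ hR
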